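/- Notation. Let $\mathbb Z^{\mathbb N^+}$ be the set of integer vectors $l=(l_1,l_2,\dots)$ with finite support, $\|l\|=\sum_{i\ge1} i\,|l_i|$, and $(\omega,l)=\sum_i l_i\omega_i$ for a real sequence $\omega=(\omega_i)_{i\ge1}$. For $r>0$, $AP_r(\omega)$ is the set of functions $F(z)=\sum_l F_l e^{i(\omega,l)z}$ on $|\operatorname{Im} z|<r$ with $F_l\in\mathbb C$ and $\sum_l|F_l|e^{r\|l\|}<\infty$, and $AP(\omega)=\bigcup_{r>0}AP_r(\omega)$; a function $\mathbb R\to\mathbb R$ is said to be in $AP(\omega)$ if it is the restriction to $\mathbb R$ of an element of $AP(\omega)$. For $r,s>0$ and a real number $\alpha$, $AP_{r,s}(\omega)$ is the set of functions $f(x,y)=\sum_l f_l(y)e^{i(\omega,l)x}$ on $\{|\operatorname{Im}x|<r\}\times\{y\in\mathbb C:|y-\alpha|<s\}$ with $f_l$ analytic and $\|f\|_{r,s}=\sum_l\big(\sup_{|y-\alpha|<s}|f_l(y)|\big)e^{r\|l\|}<\infty$. Statement. For all $\gamma,\mu,r,s>0$ there is $\varepsilon_0>0$, depending only on $\gamma,\mu,r,s$,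 such that the following holds for every $0<\varepsilon\le\varepsilon_0$. Let $\omega=(\omega_i)_{i\ge1}$ be a real sequence with $|\omega_i|\le1$ for all $i$ and, for some $\gamma_0>0$, $$|(\omega,l)|>\frac{\gamma_0}{\prod_{i\ge1}\big(1+i^{1+\mu}|l_i|^{1+\mu}\big)}\qquad\text{for all } l\in\mathbb Z^{\mathbb N^+}\setminus\{0\}.$$ Let $a,b\in\mathbb R$, $0<\delta<1$, and let $\alpha\in[a+\gamma,b-\gamma]$ satisfy $$\Big|(\omega,l)\frac{\delta\alpha}{2\pi}-n\Big|>\gamma\prod_{i\ge1}\frac1{1+i^{2+2\mu}|l_i|^{2+2\mu}}\qquad\text{for all } l\in\mathbb Z^{\mathbb N^+}\setminus\{0\},\ n\in\mathbb Z.$$ Let $f=f(\cdot,\cdot,\delta)$ and $g=g(\cdot,\cdot,\delta)$ be real-valued on $\mathbb R\times[a,b]$, in $AP_{r,s}(\omega)$, with $\|f\|_{r,s}+\|g\|_{r,s}\le\delta\varepsilon$, and suppose that the mapping $$\mathfrak M_\delta:\quad x_1=x+\delta y+f(x,y,\delta),\qquad y_1=y+g(x,y,\delta),\qquad (x,y)\in\mathbb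 R\times[a,b],$$ has the intersection property: $\mathfrak M_\delta(\Gamma)\cap\Gamma\ne\emptyset$ for every curve $\Gamma=\{(x,u(x)):x\in\mathbb R\}$ with $u:\mathbb R\to[a,b]$ in $AP(\omega)$. Then there are functions $\phi(\cdot,\delta):\mathbb R\to\mathbb R$ and $\psi(\cdot,\delta):\mathbb R\to[a,b]$ in $AP(\omega)$ such that $\xi\mapsto(\xi+\phi(\xi,\delta),\psi(\xi,\delta))$ is injective, the curve $$\Gamma_\delta:\quad x=\xi+\phi(\xi,\delta),\qquad y=\psi(\xi,\delta),\qquad \xi\in\mathbb R,$$ is invariant, $\mathfrak M_\delta(\Gamma_\delta)=\Gamma_\delta$, and the restriction of $\mathfrak M_\delta$ to $\Gamma_\delta$ is $\xi_1=\xi+\delta\alpha$, that is, $\mathfrak M_\delta$ maps the point of $\Gamma_\delta$ with parameter $\xi$ to the point with parameter $\xi+\delta\alpha$. -/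

import Mathlib

open scoped ENNReal

noncomputable section

namespace SmallTwist

/-- The integer vectors `l = (l₁, l₂, …)` with finite support. -/
abbrev IntVec : Type := ℕ+ →₀ ℤ

/-- The pairing `(ω, l) = ∑ i, lᵢ ωᵢ` (a finite sum). -/
def pairing (ω : ℕ+ → ℝ) (l : IntVec) : ℝ :=
  l.sum fun i k => (k : ℝ) * ω i

/-- The weighted length `‖l‖ = ∑ i, |lᵢ| i`. -/
def wlen (l : IntVec) : ℝ :=
  l.sum fun i k => |(k : ℝ)| * ((i : ℕ) : ℝ)

/-- The product `∏ i, (1 + i ^ τ |lᵢ| ^ τ)`. For `τ > 0` the factors outside the support of `l`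
are equal to `1`, so that the product over the support is the infinite product. -/
def dioProd (τ : ℝ) (l : IntVec) : ℝ :=
  l.prod fun i k => 1 + ((i : ℕ) : ℝ) ^ τ * |(k : ℝ)| ^ τ

/-- The frequency vector `ω` has `|ωᵢ| ≤ 1` for all `i` and
`|(ω, l)| > γ₀ / ∏ (1 + i ^ (1 + μ) |lᵢ| ^ (1 + μ))` for all `l ≠ 0`. -/
def IsDiophantine (ω : ℕ+ → ℝ) (γ₀ μ : ℝ) : Prop :=
  (∀ i, |ω i| ≤ 1) ∧
    ∀ l : IntVec, l ≠ 0 → γ₀ / dioProd (1 + μ) l < |pairing ω l|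

/-- The rotation number `β` satisfies
`|(ω, l) β / (2 π) - n| > γ ∏ 1 / (1 + i ^ (2 + 2 μ) |lᵢ| ^ (2 + 2 μ))`
for all `l ≠ 0` and all integers `n`. -/
def IsNonresonant (ω : ℕ+ → ℝ) (γ μ β : ℝ) : Prop :=
  ∀ l : IntVec, l ≠ 0 → ∀ n : ℤ,
    γ / dioProd (2 + 2 * μ) l < |pairing ω l * (β / (2 * Real.pi)) - (n : ℝ)|

/-- The exponential `e ^ (i (ω, l) z)`. -/
def expMode (ω : ℕ+ → ℝ) (l : IntVec) (z : ℂ) : ℂ :=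
  Complex.exp (Complex.I * (pairing ω l : ℂ) * z)

/-- `F` belongs to `AP_r(ω)`: on the strip `|Im z| < r` it is the sum of a series
`∑ F_l e ^ (i (ω, l) z)` with `∑ |F_l| e ^ (r ‖l‖) < ∞`. Only the values of `F` on the strip
matter. -/
def MemAPr (ω : ℕ+ → ℝ) (r : ℝ) (F : ℂ → ℂ) : Prop :=
  ∃ c : IntVec → ℂ,
    Summable (fun l => ‖c l‖ * Real.exp (r * wlen l)) ∧
    ∀ z : ℂ, |z.im| < r → HasSum (fun l => c l * expMode ω l z) (F z)

/-- `u : ℝ → ℝ` is the restriction to the real axis of an element of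
`AP(ω) = ⋃ r > 0, AP_r(ω)`. -/
def MemRealAP (ω : ℕ+ → ℝ) (u : ℝ → ℝ) : Prop :=
  ∃ r : ℝ, 0 < r ∧ ∃ F : ℂ → ℂ, MemAPr ω r F ∧ ∀ x : ℝ, F (x : ℂ) = ((u x : ℝ) : ℂ)

/-- `∑ |c_l|_s e ^ (r ‖l‖)` for a family of functions `c_l`, where `|·|_s` is the supremum over
the disc `|y - y₀| < s`; the value may be `∞`. -/
def coeffNorm (r s : ℝ) (y₀ : ℂ) (c : IntVec → ℂ → ℂ) : ℝ≥0∞ :=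
  ∑' l, (⨆ y ∈ Metric.ball y₀ s, ‖c l y‖ₑ) * ENNReal.ofReal (Real.exp (r * wlen l))

/-- `f(x, y) = ∑ c_l(y) e ^ (i (ω, l) x)` for `|Im x| < r`, `|y - y₀| < s`, with coefficients `c_l`
that are analytic in `y` and satisfy `∑ |c_l|_s e ^ (r ‖l‖) < ∞`. -/
structure IsAPSeries (ω : ℕ+ → ℝ) (r s : ℝ) (y₀ : ℂ) (f : ℂ → ℂ → ℂ)
    (c : IntVec → ℂ → ℂ) : Prop where
  analytic : ∀ l, AnalyticOnNhd ℂ (c l) (Metric.ball y₀ s)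
  norm_lt_top : coeffNorm r s y₀ c < ∞
  hasSum : ∀ x y : ℂ, |x.im| < r → y ∈ Metric.ball y₀ s →
    HasSum (fun l => c l y * expMode ω l x) (f x y)

/-- `f` belongs to `AP_{r,s}(ω)` on the domain `|Im x| < r`, `|y - y₀| < s`. -/
def MemAPrs (ω : ℕ+ → ℝ) (r s : ℝ) (y₀ : ℂ) (f : ℂ → ℂ → ℂ) : Prop :=
  ∃ c, IsAPSeries ω r s y₀ f c

/-- The norm `‖f‖_{r,s}`. For a Diophantine `ω` the exponents `(ω, l)` are pairwise distinct, so
the coefficients of `f` are unique on the disc and the infimum ranges over a single value,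
`∑ |f_l|_s e ^ (r ‖l‖)`, if `f` is in `AP_{r,s}(ω)`; otherwise the norm is `∞`. -/
def apNorm (ω : ℕ+ → ℝ) (r s : ℝ) (y₀ : ℂ) (f : ℂ → ℂ → ℂ) : ℝ≥0∞ :=
  ⨅ (c : IntVec → ℂ → ℂ) (_ : IsAPSeries ω r s y₀ f c), coeffNorm r s y₀ c

/-- `f` takes real values on `ℝ × [a, b]`. -/
def IsRealOn (a b : ℝ) (f : ℂ → ℂ → ℂ) : Prop :=
  ∀ x y : ℝ, y ∈ Set.Icc a b → (f (x : ℂ) (y : ℂ)).im = 0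

/-- The mapping `x₁ = x + δ y + f(x, y)`, `y₁ = y + g(x, y)`. It is only used at points of
`ℝ × [a, b]`, where `f` and `g` are real. -/
def twistMap (δ : ℝ) (f g : ℂ → ℂ → ℂ) (p : ℝ × ℝ) : ℝ × ℝ :=
  (p.1 + δ * p.2 + (f (p.1 : ℂ) (p.2 : ℂ)).re, p.2 + (g (p.1 : ℂ) (p.2 : ℂ)).re)

/-- The intersection property of a mapping `M` of `ℝ × [a, b]` into the plane: `M(Γ) ∩ Γ ≠ ∅` for
every real analytic almost periodic curve `Γ : y = u(x)` in `ℝ × [a, b]` with `u` in `AP(ω)`. -/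
def HasIntersectionProperty (ω : ℕ+ → ℝ) (a b : ℝ) (M : ℝ × ℝ → ℝ × ℝ) : Prop :=
  ∀ u : ℝ → ℝ, MemRealAP ω u → (∀ x, u x ∈ Set.Icc a b) →
    ((M '' Set.range fun x : ℝ => (x, u x)) ∩ Set.range fun x : ℝ => (x, u x)).Nonempty

/-- The parametrization `x = ξ + φ(ξ)`, `y = ψ(ξ)` of a curve in the plane. -/
def curve (φ ψ : ℝ → ℝ) (ξ : ℝ) : ℝ × ℝ :=
  (ξ + φ ξ, ψ ξ)

end SmallTwist

end

/-!
In the coordinates `x`, `y - α` the curve is sought as a zero of the two defects `errX`, `errY`, by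
a Newton iteration on strips of decreasing width that starts at `y = α`. The linearized equation
splits along the tangent of the approximate curve and along a normal direction, in which the
linearized mapping acts as a cocycle that is carried along as almost reduced to a constant `κ`
near `1`. Both equations then have the form `U(· + β) - κ U = E`. Their small divisors are bounded
below by the nonresonance of `β = δ α`; for real `κ ≥ 0` the distance `|e^{i(ω,l)β} - κ|` is at
least half of `|e^{i(ω,l)β} - 1|`, so `κ` may vary from step to step.

In the normal equation the mean value `C` of the right-hand side remains unsolved, and then the
vertical defect of the corrected curve is close to `C` while its horizontal defect is quadratically
small. The intersection property yields a point at which the vertical defect is dominated by the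
horizontal one, so that `C` is quadratically small as well.
-/

namespace SmallTwist

section CharacterSeries

variable {J X : Type*}

/-- `u` is the sum of a series `∑ c_j χ_j` with `∑ |c_j| W_j ≤ K`. All weighted norms of the proof
are bounded through this predicate, so that neither the coefficients nor a norm has to be chosen. -/
def SeriesNormLE (χ : J → X → ℂ) (W : J → ℝ) (K : ℝ) (u : X → ℂ) : Prop :=
  ∃ c : J → ℂ, Summable (fun j => ‖c j‖ * W j) ∧ ∑' j, ‖c j‖ * W j ≤ K ∧
    ∀ x, HasSum (fun j => c j * χ j x) (u x)

/-- A multiplicative family of functions, closed under conjugation, with submultiplicative weights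
that dominate it. The series with finite weighted norm then form a Banach algebra. -/
structure IsCharSystem [AddMonoid J] (χ : J → X → ℂ) (W : J → ℝ) : Prop where
  char_zero : ∀ x, χ 0 x = 1
  char_add : ∀ i j x, χ (i + j) x = χ i x * χ j x
  weight_pos : ∀ i, 0 < W i
  weight_zero : W 0 = 1
  weight_add : ∀ i j, W (i + j) ≤ W i * W j
  norm_le : ∀ i x, ‖χ i x‖ ≤ W i
  exists_conj : ∃ bar : J ≃ J, (∀ i, W (bar i) = W i) ∧
    ∀ i x, χ (bar i) x = (starRingEnd ℂ) (χ i x)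

variable {χ : J → X → ℂ} {W : J → ℝ} {K L : ℝ} {u v : X → ℂ}

theorem SeriesNormLE.mono (h : SeriesNormLE χ W K u) (hK : K ≤ L) : SeriesNormLE χ W L u := by
  obtain ⟨c, hc, hcK, hu⟩ := h
  exact ⟨c, hc, hcK.trans hK, hu⟩

theorem SeriesNormLE.congr (h : SeriesNormLE χ W K u) (huv : ∀ x, u x = v x) :
    SeriesNormLE χ W K v :=
  (funext huv : u = v) ▸ h

theorem SeriesNormLE.single (a : ℂ) (j : J) :
    SeriesNormLE χ W (‖a‖ * W j) (fun x => a * χ j x) := by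
  classical
  have hzero : ∀ i, i ≠ j → ‖(if i = j then a else 0 : ℂ)‖ * W i = 0 := fun i hi => by simp [hi]
  refine ⟨fun i => if i = j then a else 0, (hasSum_single j hzero).summable, ?_, fun x => ?_⟩
  · rw [tsum_eq_single j hzero]
    simp
  · simpa using hasSum_single (f := fun i => (if i = j then a else 0 : ℂ) * χ i x) j
      fun i hi => by simp [hi]

theorem SeriesNormLE.const_mul (hu : SeriesNormLE χ W K u) (a : ℂ) :
    SeriesNormLE χ W (‖a‖ * K) (fun x => a * u x) := by
  obtain ⟨c, hc, hcK, hu⟩ := hu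
  refine ⟨fun j => a * c j, ?_, ?_, fun x => ?_⟩
  · simpa only [norm_mul, mul_assoc] using hc.mul_left ‖a‖
  · simp only [norm_mul, mul_assoc]
    rw [tsum_mul_left]
    gcongr
  · simpa only [mul_assoc] using (hu x).mul_left a

theorem SeriesNormLE.of_coeff_le {c : J → ℂ} {k : J → ℝ} (hW : ∀ j, 0 ≤ W j)
    (hck : ∀ j, ‖c j‖ * W j ≤ k j) (hk : Summable k) (hkK : ∑' j, k j ≤ K)
    (hu : ∀ x, HasSum (fun j => c j * χ j x) (u x)) : SeriesNormLE χ W K u := by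
  have hc : Summable fun j => ‖c j‖ * W j :=
    hk.of_nonneg_of_le (fun j => mul_nonneg (norm_nonneg _) (hW j)) hck
  exact ⟨c, hc, (hc.tsum_le_tsum hck hk).trans hkK, hu⟩

variable [AddMonoid J]

theorem IsCharSystem.norm_mul_le (hS : IsCharSystem χ W) (a : ℂ) (j : J) (x : X) :
    ‖a * χ j x‖ ≤ ‖a‖ * W j := by
  rw [norm_mul]
  exact mul_le_mul_of_nonneg_left (hS.norm_le j x) (norm_nonneg _)

theorem IsCharSystem.summable_of_coeff_le (hS : IsCharSystem χ W) {c : J → ℂ} {k : J → ℝ}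
    (hck : ∀ j, ‖c j‖ * W j ≤ k j) (hk : Summable k) (x : X) :
    Summable fun j => c j * χ j x :=
  .of_norm_bounded hk fun j => (hS.norm_mul_le _ j x).trans (hck j)

theorem IsCharSystem.weight_nonneg (hS : IsCharSystem χ W) (j : J) : 0 ≤ W j :=
  (hS.weight_pos j).le

theorem SeriesNormLE.nonneg (hS : IsCharSystem χ W) (hu : SeriesNormLE χ W K u) : 0 ≤ K := by
  obtain ⟨c, -, hcK, -⟩ := hu
  exact (tsum_nonneg fun j => mul_nonneg (norm_nonneg _) (hS.weight_nonneg j)).trans hcK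

theorem SeriesNormLE.norm_le (hS : IsCharSystem χ W) (hu : SeriesNormLE χ W K u) (x : X) :
    ‖u x‖ ≤ K := by
  obtain ⟨c, hc, hcK, hu⟩ := hu
  rw [← (hu x).tsum_eq]
  exact (tsum_of_norm_bounded hc.hasSum fun j => hS.norm_mul_le _ j x).trans hcK

theorem SeriesNormLE.const (hS : IsCharSystem χ W) (a : ℂ) :
    SeriesNormLE χ W ‖a‖ (fun _ => a) := by
  simpa [hS.weight_zero, hS.char_zero] using SeriesNormLE.single (χ := χ) (W := W) a 0

theorem SeriesNormLE.hasSum {ι : Type*} (hS : IsCharSystem χ W) {k : ι → ℝ} {f : ι → X → ℂ}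
    (hf : ∀ i, SeriesNormLE χ W (k i) (f i)) (hk : Summable k) (hkL : ∑' i, k i ≤ L)
    (hu : ∀ x, HasSum (fun i => f i x) (u x)) : SeriesNormLE χ W L u := by
  choose c hc hck hcf using hf
  have hnonneg : ∀ i j, 0 ≤ ‖c i j‖ * W j := fun i j =>
    mul_nonneg (norm_nonneg _) (hS.weight_nonneg j)
  have hrow : Summable fun i => ∑' j, ‖c i j‖ * W j :=
    hk.of_nonneg_of_le (fun i => tsum_nonneg (hnonneg i)) hck
  have hprod : Summable fun p : ι × J => ‖c p.1 p.2‖ * W p.2 :=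
    (summable_prod_of_nonneg fun p => hnonneg p.1 p.2).2 ⟨hc, hrow⟩
  have hswap : Summable fun p : J × ι => ‖c p.2 p.1‖ * W p.1 :=
    (Equiv.prodComm J ι).summable_iff.2 hprod
  have hcol : ∀ j, Summable fun i => ‖c i j‖ := fun j => by
    simpa [mul_assoc, (hS.weight_pos j).ne'] using (hswap.prod_factor j).mul_right (W j)⁻¹
  refine SeriesNormLE.of_coeff_le (c := fun j => ∑' i, c i j) (k := fun j => ∑' i, ‖c i j‖ * W j)
    hS.weight_nonneg (fun j => ?_) hswap.prod ?_ fun x => ?_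
  · rw [tsum_mul_right]
    exact mul_le_mul_of_nonneg_right (norm_tsum_le_tsum_norm (hcol j)) (hS.weight_nonneg j)
  · calc ∑' j, ∑' i, ‖c i j‖ * W j = ∑' i, ∑' j, ‖c i j‖ * W j :=
          Summable.tsum_comm (f := fun i j => ‖c i j‖ * W j) hprod
      _ ≤ ∑' i, k i := hrow.tsum_le_tsum hck hk
      _ ≤ L := hkL
  · have hterms : Summable fun p : ι × J => c p.1 p.2 * χ p.2 x :=
      .of_norm_bounded hprod fun p => hS.norm_mul_le _ _ x
    have hdouble : HasSum (fun p : ι × J => c p.1 p.2 * χ p.2 x) (u x) :=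
      (hu x).unique (hterms.hasSum.prod_fiberwise fun i => hcf i x) ▸ hterms.hasSum
    have hdouble' : HasSum (fun p : J × ι => c p.2 p.1 * χ p.1 x) (u x) :=
      (Equiv.prodComm J ι).hasSum_iff.2 hdouble
    simpa only [tsum_mul_right] using
      hdouble'.prod_fiberwise fun j => (hdouble'.summable.prod_factor j).hasSum

theorem SeriesNormLE.add (hS : IsCharSystem χ W) (hu : SeriesNormLE χ W K u)
    (hv : SeriesNormLE χ W L v) : SeriesNormLE χ W (K + L) (fun x => u x + v x) := by
  refine SeriesNormLE.hasSum (ι := Bool) (k := fun b => cond b K L) (f := fun b => cond b u v) hS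
    (fun b => ?_) (hasSum_fintype _).summable (by simp) fun x => ?_
  · cases b <;> simpa
  · convert hasSum_fintype (fun b => (cond b u v : X → ℂ) x) using 1
    simp

theorem SeriesNormLE.mul (hS : IsCharSystem χ W) (hu : SeriesNormLE χ W K u)
    (hv : SeriesNormLE χ W L v) : SeriesNormLE χ W (K * L) (fun x => u x * v x) := by
  have hK := hu.nonneg hS
  obtain ⟨c, hc, hcK, hu⟩ := hu
  obtain ⟨d, hd, hdL, hv⟩ := hv
  have hcW : ∀ j, 0 ≤ ‖c j‖ * W j := fun j => mul_nonneg (norm_nonneg _) (hS.weight_nonneg j)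
  have hdW : ∀ j, 0 ≤ ‖d j‖ * W j := fun j => mul_nonneg (norm_nonneg _) (hS.weight_nonneg j)
  have hcd := hc.mul_of_nonneg hd hcW hdW
  refine SeriesNormLE.hasSum (ι := J × J) hS
    (f := fun p x => (c p.1 * d p.2) * χ (p.1 + p.2) x)
    (k := fun p => (‖c p.1‖ * W p.1) * (‖d p.2‖ * W p.2)) (fun p => ?_) hcd ?_ fun x => ?_
  · refine (SeriesNormLE.single _ _).mono ?_
    calc ‖c p.1 * d p.2‖ * W (p.1 + p.2) ≤ ‖c p.1‖ * ‖d p.2‖ * (W p.1 * W p.2) := by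
          rw [norm_mul]
          gcongr
          exact hS.weight_add _ _
      _ = (‖c p.1‖ * W p.1) * (‖d p.2‖ * W p.2) := by ring
  · rw [← hc.tsum_mul_tsum hd hcd]
    exact mul_le_mul hcK hdL (tsum_nonneg hdW) hK
  · have hcx : Summable fun j => ‖c j * χ j x‖ :=
      .of_nonneg_of_le (fun _ => norm_nonneg _) (fun j => hS.norm_mul_le _ j x) hc
    have hdx : Summable fun j => ‖d j * χ j x‖ :=
      .of_nonneg_of_le (fun _ => norm_nonneg _) (fun j => hS.norm_mul_le _ j x) hd
    have hprod := summable_mul_of_summable_norm hcx hdx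
    refine ((hu x).mul (hv x) hprod).congr_fun fun p => ?_
    rw [hS.char_add]
    ring

theorem SeriesNormLE.pow (hS : IsCharSystem χ W) (hu : SeriesNormLE χ W K u) (n : ℕ) :
    SeriesNormLE χ W (K ^ n) (fun x => u x ^ n) := by
  induction n with
  | zero => simpa using SeriesNormLE.const hS (1 : ℂ)
  | succ n ih => simpa only [pow_succ] using ih.mul hS hu

theorem SeriesNormLE.powerSeries (hS : IsCharSystem χ W) (hu : SeriesNormLE χ W K u) {a : ℕ → ℂ}
    (ha : HasSum (fun n => ‖a n‖ * K ^ n) L) (hv : ∀ x, HasSum (fun n => a n * u x ^ n) (v x)) :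
    SeriesNormLE χ W L v :=
  SeriesNormLE.hasSum hS (fun n => (hu.pow hS n).const_mul (a n)) ha.summable ha.tsum_eq.le hv

theorem SeriesNormLE.cexp (hS : IsCharSystem χ W) (hu : SeriesNormLE χ W K u) (z : ℂ) :
    SeriesNormLE χ W (Real.exp (‖z‖ * K)) (fun x => Complex.exp (z * u x)) := by
  refine hu.powerSeries hS (a := fun n => z ^ n / (n.factorial : ℂ)) ?_ fun x => ?_
  · have hexp := NormedSpace.expSeries_div_hasSum_exp (𝔸 := ℝ) (‖z‖ * K)
    rw [← Real.exp_eq_exp_ℝ] at hexp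
    refine hexp.congr_fun fun n => ?_
    rw [norm_div, norm_pow, Complex.norm_natCast, mul_pow]
    ring
  · have hexp := NormedSpace.expSeries_div_hasSum_exp (𝔸 := ℂ) (z * u x)
    rw [← Complex.exp_eq_exp_ℂ] at hexp
    refine hexp.congr_fun fun n => ?_
    rw [mul_pow]
    ring

theorem SeriesNormLE.inv_one_add (hS : IsCharSystem χ W) (hu : SeriesNormLE χ W K u)
    (hK : K < 1) : SeriesNormLE χ W (1 - K)⁻¹ (fun x => (1 + u x)⁻¹) := by
  refine hu.powerSeries hS (a := fun n => (-1) ^ n) ?_ fun x => ?_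
  · simpa using hasSum_geometric_of_lt_one (hu.nonneg hS) hK
  · have hux : ‖-u x‖ < 1 := by
      rw [norm_neg]
      exact (hu.norm_le hS x).trans_lt hK
    simpa [← mul_pow] using hasSum_geometric_of_norm_lt_one hux

theorem SeriesNormLE.inv_one_add_sub_one (hS : IsCharSystem χ W) (hu : SeriesNormLE χ W K u)
    (hK : K < 1) : SeriesNormLE χ W ((1 - K)⁻¹ * K) (fun x => (1 + u x)⁻¹ - 1) := by
  refine ((((hu.inv_one_add hS hK).mul hS hu).const_mul (-1)).mono (by simp)).congr fun x => ?_
  have hne : 1 + u x ≠ 0 := fun h => by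
    have hux := hu.norm_le hS x
    rw [eq_neg_of_add_eq_zero_right h, norm_neg, norm_one] at hux
    exact absurd hux (not_le.2 hK)
  field_simp
  ring

theorem SeriesNormLE.conj (hS : IsCharSystem χ W) (hu : SeriesNormLE χ W K u) :
    SeriesNormLE χ W K (fun x => (starRingEnd ℂ) (u x)) := by
  obtain ⟨bar, weight_bar, char_bar⟩ := hS.exists_conj
  obtain ⟨c, hc, hcK, hu⟩ := hu
  have hcoeff : (fun j => ‖(starRingEnd ℂ) (c (bar.symm j))‖ * W j)
      = (fun j => ‖c j‖ * W j) ∘ bar.symm := by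
    funext j
    simp [← weight_bar (bar.symm j)]
  refine ⟨fun j => (starRingEnd ℂ) (c (bar.symm j)), ?_, ?_, fun x => ?_⟩
  · rwa [hcoeff, bar.symm.summable_iff]
  · rw [hcoeff]
    exact (bar.symm.tsum_eq (fun j => ‖c j‖ * W j)).trans_le hcK
  · rw [← bar.hasSum_iff]
    refine (Complex.hasSum_conj'.2 (hu x)).congr_fun fun j => ?_
    simp [char_bar]

theorem SeriesNormLE.re (hS : IsCharSystem χ W) (hu : SeriesNormLE χ W K u) :
    SeriesNormLE χ W K (fun x => ((u x).re : ℂ)) := by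
  refine (((hu.add hS (hu.conj hS)).const_mul (1 / 2)).mono ?_).congr fun x => ?_
  · norm_num
    linarith
  · rw [Complex.add_conj]
    push_cast
    ring

end CharacterSeries

section Exponents

variable {ω : ℕ+ → ℝ}

theorem wlen_nonneg (l : IntVec) : 0 ≤ wlen l :=
  Finset.sum_nonneg fun _ _ => by positivity

theorem wlen_zero : wlen 0 = 0 := Finsupp.sum_zero_index

theorem wlen_eq_sum {l : IntVec} {s : Finset ℕ+} (h : l.support ⊆ s) :
    wlen l = ∑ i ∈ s, |(l i : ℝ)| * ((i : ℕ) : ℝ) :=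
  Finsupp.sum_of_support_subset _ h _ (by simp)

theorem wlen_add_le (k l : IntVec) : wlen (k + l) ≤ wlen k + wlen l := by
  classical
  rw [wlen_eq_sum (s := k.support ∪ l.support) Finsupp.support_add,
    wlen_eq_sum (l := k) Finset.subset_union_left,
    wlen_eq_sum (l := l) Finset.subset_union_right, ← Finset.sum_add_distrib]
  refine Finset.sum_le_sum fun i _ => ?_
  rw [← add_mul, Finsupp.add_apply, Int.cast_add]
  exact mul_le_mul_of_nonneg_right (abs_add_le _ _) (Nat.cast_nonneg _)

theorem wlen_neg (l : IntVec) : wlen (-l) = wlen l := by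
  rw [wlen_eq_sum (s := l.support) (by rw [Finsupp.support_neg]), wlen_eq_sum subset_rfl]
  simp

theorem wlen_le_exp_div {σ : ℝ} (hσ : 0 < σ) (l : IntVec) :
    wlen l ≤ Real.exp (σ * wlen l) / σ := by
  rw [le_div_iff₀ hσ]
  linarith [Real.add_one_le_exp (σ * wlen l)]

theorem pairing_zero : pairing ω 0 = 0 := Finsupp.sum_zero_index

theorem pairing_add (k l : IntVec) : pairing ω (k + l) = pairing ω k + pairing ω l := by
  classical
  exact Finsupp.sum_add_index' (by simp) (by intros; push_cast; ring)

theorem pairing_neg (l : IntVec) : pairing ω (-l) = -pairing ω l := by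
  have h := pairing_add (ω := ω) l (-l)
  rw [add_neg_cancel, pairing_zero] at h
  linarith

theorem abs_pairing_le_wlen (hω : ∀ i, |ω i| ≤ 1) (l : IntVec) : |pairing ω l| ≤ wlen l := by
  refine (Finset.abs_sum_le_sum_abs _ _).trans (Finset.sum_le_sum fun i _ => ?_)
  rw [abs_mul]
  refine mul_le_mul_of_nonneg_left ((hω i).trans ?_) (abs_nonneg _)
  exact_mod_cast i.pos

theorem norm_I_mul_pairing_le (hω : ∀ i, |ω i| ≤ 1) (l : IntVec) :
    ‖Complex.I * (pairing ω l : ℂ)‖ ≤ wlen l := by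
  simpa using abs_pairing_le_wlen hω l

theorem expMode_zero (z : ℂ) : expMode ω 0 z = 1 := by simp [expMode, pairing_zero]

theorem expMode_add (k l : IntVec) (z : ℂ) :
    expMode ω (k + l) z = expMode ω k z * expMode ω l z := by
  rw [expMode, expMode, expMode, ← Complex.exp_add, pairing_add]
  push_cast
  ring_nf

theorem expMode_arg_add (l : IntVec) (z w : ℂ) :
    expMode ω l (z + w) = expMode ω l z * expMode ω l w := by
  rw [expMode, expMode, expMode, ← Complex.exp_add]
  ring_nf

theorem norm_expMode (l : IntVec) (z : ℂ) :
    ‖expMode ω l z‖ = Real.exp (-(pairing ω l * z.im)) := by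
  rw [expMode, Complex.norm_exp]
  simp [Complex.mul_re, Complex.mul_im]

theorem norm_expMode_real (l : IntVec) (x : ℝ) : ‖expMode ω l (x : ℂ)‖ = 1 := by
  simp [norm_expMode]

theorem expMode_neg_real (l : IntVec) (x : ℝ) :
    expMode ω (-l) (x : ℂ) = (starRingEnd ℂ) (expMode ω l (x : ℂ)) := by
  rw [expMode, expMode, ← Complex.exp_conj, pairing_neg]
  simp

theorem hasDerivAt_expMode (l : IntVec) (x : ℝ) :
    HasDerivAt (fun x : ℝ => expMode ω l (x : ℂ))
      (Complex.I * (pairing ω l : ℂ) * expMode ω l (x : ℂ)) x := by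
  have h := ((hasDerivAt_id (x : ℂ)).const_mul (Complex.I * (pairing ω l : ℂ))).cexp.comp_ofReal
  simp only [id, mul_one] at h
  rw [mul_comm]
  exact h

end Exponents

section Norms

variable {ω : ℕ+ → ℝ} {ρ r s K L : ℝ}

/-- The exponentials `e ^ (i (ω, l) x)` on the real line. -/
noncomputable def lineChar (ω : ℕ+ → ℝ) (l : IntVec) (x : ℝ) : ℂ := expMode ω l (x : ℂ)

/-- The weights `e ^ (ρ ‖l‖)` of the norm of `AP_ρ(ω)`. -/
noncomputable def lineWeight (ρ : ℝ) (l : IntVec) : ℝ := Real.exp (ρ * wlen l)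

/-- The products `e ^ (i (ω, l) x) y ^ k` on the band `|y| ≤ s`. -/
noncomputable def bandChar (ω : ℕ+ → ℝ) (s : ℝ) (j : IntVec × ℕ) (x : ℝ × Set.Icc (-s) s) : ℂ :=
  expMode ω j.1 (x.1 : ℂ) * ((x.2 : ℝ) : ℂ) ^ j.2

/-- The weights `e ^ (r ‖l‖) s ^ k`. They replace the supremum over the disc `|y| < s` in the norm
of `AP_{r,s}(ω)` by the larger sum of the absolute values of the Taylor terms. -/
noncomputable def bandWeight (r s : ℝ) (j : IntVec × ℕ) : ℝ := lineWeight r j.1 * s ^ j.2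

theorem lineWeight_pos (ρ : ℝ) (l : IntVec) : 0 < lineWeight ρ l := Real.exp_pos _

theorem one_le_lineWeight (hρ : 0 ≤ ρ) (l : IntVec) : 1 ≤ lineWeight ρ l :=
  Real.one_le_exp (mul_nonneg hρ (wlen_nonneg l))

theorem lineWeight_add_le (hρ : 0 ≤ ρ) (k l : IntVec) :
    lineWeight ρ (k + l) ≤ lineWeight ρ k * lineWeight ρ l := by
  rw [lineWeight, lineWeight, lineWeight, ← Real.exp_add, ← mul_add]
  exact Real.exp_le_exp.2 (mul_le_mul_of_nonneg_left (wlen_add_le k l) hρ)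

theorem isCharSystem_line (ω : ℕ+ → ℝ) (hρ : 0 ≤ ρ) :
    IsCharSystem (lineChar ω) (lineWeight ρ) where
  char_zero x := expMode_zero _
  char_add i j x := expMode_add _ _ _
  weight_pos := lineWeight_pos ρ
  weight_zero := by simp [lineWeight, wlen_zero]
  weight_add := lineWeight_add_le hρ
  norm_le i x := (norm_expMode_real i x).trans_le (one_le_lineWeight hρ i)
  exists_conj := ⟨Equiv.neg _, fun i => by simp [lineWeight, wlen_neg],
    fun i x => expMode_neg_real i x⟩

theorem isCharSystem_band (ω : ℕ+ → ℝ) (hr : 0 ≤ r) (hs : 0 < s) :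
    IsCharSystem (bandChar ω s) (bandWeight r s) where
  char_zero x := by simp [bandChar, expMode_zero]
  char_add i j x := by
    simp only [bandChar, Prod.fst_add, Prod.snd_add, expMode_add, pow_add]
    ring
  weight_pos i := mul_pos (lineWeight_pos r i.1) (pow_pos hs _)
  weight_zero := by simp [bandWeight, lineWeight, wlen_zero]
  weight_add i j :=
    calc lineWeight r (i.1 + j.1) * s ^ (i.2 + j.2)
        ≤ lineWeight r i.1 * lineWeight r j.1 * s ^ (i.2 + j.2) := by
          gcongr
          exact lineWeight_add_le hr _ _
      _ = bandWeight r s i * bandWeight r s j := by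
          rw [bandWeight, bandWeight, pow_add]
          ring
  norm_le i x := by
    rw [bandChar, norm_mul, norm_expMode_real, one_mul, norm_pow, Complex.norm_real,
      Real.norm_eq_abs]
    exact (pow_le_pow_left₀ (abs_nonneg _) (abs_le.2 x.2.2) _).trans
      (le_mul_of_one_le_left (pow_pos hs _).le (one_le_lineWeight hr i.1))
  exists_conj := ⟨(Equiv.neg _).prodCongr (Equiv.refl _),
    fun i => by simp [bandWeight, lineWeight, wlen_neg],
    fun i x => by simp [bandChar, expMode_neg_real]⟩

/-- The real function `u` has norm at most `K` in `AP_ρ(ω)`. The width `ρ = 0` is allowed. -/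
structure APNormLE (ω : ℕ+ → ℝ) (ρ K : ℝ) (u : ℝ → ℝ) : Prop where
  width_nonneg : 0 ≤ ρ
  series : SeriesNormLE (lineChar ω) (lineWeight ρ) K fun x => (u x : ℂ)

/-- On `|y| ≤ s` the real function `F` is the sum of a series in `e ^ (i (ω, l) x) y ^ k` whose
norm with the weights `e ^ (r ‖l‖) s ^ k` is at most `K`. -/
structure BandNormLE (ω : ℕ+ → ℝ) (r s K : ℝ) (F : ℝ → ℝ → ℝ) : Prop where
  width_nonneg : 0 ≤ r
  height_pos : 0 < s
  series : SeriesNormLE (bandChar ω s) (bandWeight r s) K fun x => (F x.1 x.2 : ℂ)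

variable {u v : ℝ → ℝ} {F : ℝ → ℝ → ℝ}

theorem APNormLE.isCharSystem (hu : APNormLE ω ρ K u) : IsCharSystem (lineChar ω) (lineWeight ρ) :=
  isCharSystem_line ω hu.width_nonneg

theorem BandNormLE.mono (hF : BandNormLE ω r s K F) (hK : K ≤ L) : BandNormLE ω r s L F :=
  ⟨hF.width_nonneg, hF.height_pos, hF.series.mono hK⟩

namespace APNormLE

theorem mono (hu : APNormLE ω ρ K u) (hK : K ≤ L) : APNormLE ω ρ L u :=
  ⟨hu.width_nonneg, hu.series.mono hK⟩

theorem congr (hu : APNormLE ω ρ K u) (huv : ∀ x, u x = v x) : APNormLE ω ρ K v :=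
  (funext huv : u = v) ▸ hu

theorem nonneg (hu : APNormLE ω ρ K u) : 0 ≤ K :=
  hu.series.nonneg hu.isCharSystem

theorem abs_le (hu : APNormLE ω ρ K u) (x : ℝ) : |u x| ≤ K := by
  simpa using hu.series.norm_le hu.isCharSystem x

theorem const (hρ : 0 ≤ ρ) (a : ℝ) : APNormLE ω ρ |a| fun _ => a :=
  ⟨hρ, (SeriesNormLE.const (isCharSystem_line ω hρ) (a : ℂ)).mono (by simp)⟩

theorem zero (hρ : 0 ≤ ρ) : APNormLE ω ρ 0 fun _ => 0 :=
  (const hρ 0).mono abs_zero.le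

theorem add (hu : APNormLE ω ρ K u) (hv : APNormLE ω ρ L v) :
    APNormLE ω ρ (K + L) fun x => u x + v x :=
  ⟨hu.width_nonneg, (hu.series.add hu.isCharSystem hv.series).congr fun x => by push_cast; rfl⟩

theorem const_mul (hu : APNormLE ω ρ K u) (a : ℝ) : APNormLE ω ρ (|a| * K) fun x => a * u x :=
  ⟨hu.width_nonneg,
    ((hu.series.const_mul (a : ℂ)).mono (by simp)).congr fun x => by push_cast; rfl⟩

theorem neg (hu : APNormLE ω ρ K u) : APNormLE ω ρ K fun x => -u x :=
  ((hu.const_mul (-1)).mono (by simp)).congr fun x => by ring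

theorem sub (hu : APNormLE ω ρ K u) (hv : APNormLE ω ρ L v) :
    APNormLE ω ρ (K + L) fun x => u x - v x :=
  (hu.add hv.neg).congr fun x => by ring

theorem mul (hu : APNormLE ω ρ K u) (hv : APNormLE ω ρ L v) :
    APNormLE ω ρ (K * L) fun x => u x * v x :=
  ⟨hu.width_nonneg, (hu.series.mul hu.isCharSystem hv.series).congr fun x => by push_cast; rfl⟩

theorem inv_one_add_sub_one (hu : APNormLE ω ρ K u) (hK : K < 1) :
    APNormLE ω ρ ((1 - K)⁻¹ * K) fun x => (1 + u x)⁻¹ - 1 :=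
  ⟨hu.width_nonneg,
    (hu.series.inv_one_add_sub_one hu.isCharSystem hK).congr fun x => by push_cast; rfl⟩

theorem mono_width {ρ' : ℝ} (hu : APNormLE ω ρ K u) (hρ' : 0 ≤ ρ') (hρ : ρ' ≤ ρ) :
    APNormLE ω ρ' K u := by
  obtain ⟨c, hc, hcK, hsum⟩ := hu.series
  refine ⟨hρ', .of_coeff_le (fun l => (lineWeight_pos ρ' l).le) (fun l => ?_) hc hcK hsum⟩
  have hweight : lineWeight ρ' l ≤ lineWeight ρ l :=
    Real.exp_le_exp.2 (mul_le_mul_of_nonneg_right hρ (wlen_nonneg l))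
  gcongr

theorem shift (hu : APNormLE ω ρ K u) (β : ℝ) : APNormLE ω ρ K fun x => u (x + β) := by
  obtain ⟨c, hc, hcK, hsum⟩ := hu.series
  refine ⟨hu.width_nonneg, .of_coeff_le (c := fun l => c l * expMode ω l (β : ℂ))
    (fun l => (lineWeight_pos ρ l).le) (fun l => ?_) hc hcK fun x => ?_⟩
  · rw [norm_mul, norm_expMode_real, mul_one]
  · refine (hsum (x + β)).congr_fun fun l => ?_
    rw [lineChar, lineChar, Complex.ofReal_add, expMode_arg_add]
    ring

theorem exists_limit {w : ℕ → ℝ → ℝ} {k : ℕ → ℝ} (hzero : APNormLE ω ρ K (w 0))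
    (hincr : ∀ n, APNormLE ω ρ (k n) fun x => w (n + 1) x - w n x) (hk : Summable k) :
    ∃ u : ℝ → ℝ, APNormLE ω ρ (K + ∑' n, k n) u ∧
      ∀ x, Filter.Tendsto (fun n => w n x) Filter.atTop (nhds (u x)) := by
  have hsum : ∀ x, Summable fun n => w (n + 1) x - w n x := fun x =>
    .of_norm_bounded hk fun n => (hincr n).abs_le x
  refine ⟨fun x => w 0 x + ∑' n, (w (n + 1) x - w n x), ?_, fun x => ?_⟩
  · refine hzero.add ⟨hzero.width_nonneg, .hasSum hzero.isCharSystem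
      (fun n => (hincr n).series) hk le_rfl fun x => ?_⟩
    simpa using Complex.hasSum_ofReal.2 (hsum x).hasSum
  · have hlim := (hsum x).hasSum.tendsto_sum_nat
    simp only [Finset.sum_range_sub (fun n => w n x)] at hlim
    simpa using hlim.const_add (w 0 x)

end APNormLE

end Norms

section Composition

variable {ω : ℕ+ → ℝ} {ρ r s K A B a h : ℝ} {F : ℝ → ℝ → ℝ} {u p v q w : ℝ → ℝ}

-- Each term `c e ^ (i (ω, l) (x₀ + P)) V ^ k` has norm at most `|c| e ^ ((ρ + A) ‖l‖) B ^ k`,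
-- because `|(ω, l)| ≤ ‖l‖`.
theorem BandNormLE.comp {J X : Type*} [AddMonoid J] {χ : J → X → ℂ} {W : J → ℝ}
    (hω : ∀ i, |ω i| ≤ 1) (hF : BandNormLE ω r s K F) (hS : IsCharSystem χ W) {x₀ P V : X → ℝ}
    (hx₀ : ∀ l, SeriesNormLE χ W (lineWeight ρ l) fun x => expMode ω l (x₀ x : ℂ))
    (hP : SeriesNormLE χ W A fun x => (P x : ℂ)) (hV : SeriesNormLE χ W B fun x => (V x : ℂ))
    (hA : ρ + A ≤ r) (hB : B ≤ s) :
    SeriesNormLE χ W K fun x => (F (x₀ x + P x) (V x) : ℂ) := by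
  have hA0 := hP.nonneg hS
  have hB0 := hV.nonneg hS
  obtain ⟨c, hc, hcK, hsum⟩ := hF.series
  have hVs : ∀ x, V x ∈ Set.Icc (-s) s := fun x => abs_le.1 <| by
    simpa using (hV.norm_le hS x).trans hB
  refine .hasSum hS (k := fun j => ‖c j‖ * bandWeight r s j)
    (f := fun j x => c j * (expMode ω j.1 (x₀ x : ℂ) *
      (Complex.exp ((Complex.I * (pairing ω j.1 : ℂ)) * (P x : ℂ)) * (V x : ℂ) ^ j.2)))
    (fun j => ?_) hc hcK fun x => ?_
  · refine (((hx₀ j.1).mul hS ((hP.cexp hS _).mul hS (hV.pow hS j.2))).const_mul (c j)).mono ?_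
    have hexp : lineWeight ρ j.1 * Real.exp (‖Complex.I * (pairing ω j.1 : ℂ)‖ * A)
        ≤ lineWeight r j.1 := by
      rw [lineWeight, lineWeight, ← Real.exp_add, Real.exp_le_exp]
      calc ρ * wlen j.1 + ‖Complex.I * (pairing ω j.1 : ℂ)‖ * A
          ≤ ρ * wlen j.1 + wlen j.1 * A := by
            gcongr
            exact norm_I_mul_pairing_le hω j.1
        _ = (ρ + A) * wlen j.1 := by ring
        _ ≤ r * wlen j.1 := mul_le_mul_of_nonneg_right hA (wlen_nonneg _)
    rw [bandWeight, ← mul_assoc (lineWeight ρ j.1)]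
    have hW := (lineWeight_pos r j.1).le
    gcongr
  · refine (hsum (x₀ x + P x, ⟨V x, hVs x⟩)).congr_fun fun j => ?_
    simp only [bandChar, Complex.ofReal_add, expMode_arg_add]
    simp only [expMode, mul_assoc]

theorem BandNormLE.comp_line (hω : ∀ i, |ω i| ≤ 1) (hF : BandNormLE ω r s K F)
    (hp : APNormLE ω ρ A p) (hv : APNormLE ω ρ B v) (hA : ρ + A ≤ r) (hB : B ≤ s) :
    APNormLE ω ρ K fun x => F (x + p x) (v x) := by
  refine ⟨hp.width_nonneg, hF.comp hω hp.isCharSystem (x₀ := fun x => x) (fun l => ?_)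
    hp.series hv.series hA hB⟩
  simpa [lineChar] using SeriesNormLE.single (χ := lineChar ω) (W := lineWeight ρ) 1 l

theorem APNormLE.toBand (hu : APNormLE ω ρ K u) (hs : 0 < s) :
    BandNormLE ω ρ s K fun x _ => u x := by
  obtain ⟨c, hc, hcK, hsum⟩ := hu.series
  refine ⟨hu.width_nonneg, hs, .hasSum (isCharSystem_band ω hu.width_nonneg hs)
    (f := fun l x => c l * bandChar ω s (l, 0) x) (k := fun l => ‖c l‖ * lineWeight ρ l)
    (fun l => (SeriesNormLE.single (c l) (l, 0)).mono (by simp [bandWeight])) hc hcK fun x => ?_⟩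
  simpa [bandChar, lineChar] using hsum x.1

theorem APNormLE.comp_shift (hω : ∀ i, |ω i| ≤ 1) (hu : APNormLE ω r K u)
    (hp : APNormLE ω ρ A p) (hA : ρ + A ≤ r) : APNormLE ω ρ K fun x => u (x + p x) :=
  (hu.toBand one_pos).comp_line hω hp (APNormLE.zero hp.width_nonneg) hA zero_le_one

theorem BandNormLE.snd (hr : 0 ≤ r) (hs : 0 < s) : BandNormLE ω r s s fun _ y => y :=
  ⟨hr, hs, by
    simpa [bandWeight, lineWeight, bandChar, wlen_zero, expMode_zero] using
      SeriesNormLE.single (χ := bandChar ω s) (W := bandWeight r s) 1 (0, 1)⟩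

theorem APNormLE.segment (hu : APNormLE ω ρ A u) (hw : APNormLE ω ρ a w) (ha : 0 < a)
    (hh : 0 < h) : BandNormLE ω ρ (h / a) (A + h) fun x t => u x + t * w x := by
  have hs : 0 < h / a := by positivity
  have htw := (BandNormLE.snd hu.width_nonneg hs).series.mul
    (isCharSystem_band ω hu.width_nonneg hs) (hw.toBand hs).series
  rw [div_mul_cancel₀ _ ha.ne'] at htw
  exact ⟨hu.width_nonneg, hs, ((hu.toBand hs).series.add
    (isCharSystem_band ω hu.width_nonneg hs) htw).congr fun x => by push_cast; rfl⟩

theorem BandNormLE.segment (hω : ∀ i, |ω i| ≤ 1) (hF : BandNormLE ω r s K F)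
    (hp : APNormLE ω ρ A p) (hv : APNormLE ω ρ B v) (hq : APNormLE ω ρ a q)
    (hw : APNormLE ω ρ a w) (ha : 0 < a) (hh : 0 < h) (hr : ρ + A + h ≤ r) (hs : B + h ≤ s) :
    BandNormLE ω ρ (h / a) K fun x t => F (x + (p x + t * q x)) (v x + t * w x) := by
  have hS := isCharSystem_band ω hp.width_nonneg (div_pos hh ha)
  refine ⟨hp.width_nonneg, div_pos hh ha, hF.comp (ρ := ρ) hω hS (x₀ := fun x => x.1)
    (fun l => ?_) (hp.segment hq ha hh).series (hv.segment hw ha hh).series (by linarith) hs⟩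
  simpa [bandWeight, bandChar] using
    SeriesNormLE.single (χ := bandChar ω (h / a)) (W := bandWeight ρ (h / a)) 1 (l, 0)

end Composition

section Derivatives

variable {ω : ℕ+ → ℝ} {ρ σ r s K : ℝ} {u : ℝ → ℝ} {F : ℝ → ℝ → ℝ}

theorem hasSum_deriv_of_hasSum_lineChar (hω : ∀ i, |ω i| ≤ 1) (hρ : 0 < ρ) {c : IntVec → ℂ}
    (hc : Summable fun l => ‖c l‖ * lineWeight ρ l)
    (hu : ∀ x, HasSum (fun l => c l * lineChar ω l x) (u x : ℂ)) (x : ℝ) :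
    DifferentiableAt ℝ u x ∧
      HasSum (fun l => c l * (Complex.I * pairing ω l) * lineChar ω l x) ((deriv u x : ℝ) : ℂ) := by
  have hbound : ∀ l x, ‖c l * (Complex.I * pairing ω l) * lineChar ω l x‖
      ≤ ‖c l‖ * lineWeight ρ l / ρ := fun l x => by
    rw [norm_mul, norm_mul, lineChar, norm_expMode_real, mul_one, mul_div_assoc]
    gcongr
    exact (norm_I_mul_pairing_le hω l).trans (wlen_le_exp_div hρ l)
  have hterm : ∀ l x, HasDerivAt (fun x => c l * lineChar ω l x)
      (c l * (Complex.I * pairing ω l) * lineChar ω l x) x := fun l x => by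
    simpa only [mul_assoc, lineChar] using (hasDerivAt_expMode (ω := ω) l x).const_mul (c l)
  have hseries := hasDerivAt_tsum (hc.div_const ρ) hterm hbound (hu 0).summable x
  have hderiv : HasDerivAt (fun x => (u x : ℂ))
      (∑' l, c l * (Complex.I * pairing ω l) * lineChar ω l x) x := by
    simpa only [(hu _).tsum_eq] using hseries
  have hdiff : DifferentiableAt ℝ u x :=
    (Complex.reCLM.hasFDerivAt.comp_hasDerivAt x hderiv).differentiableAt
  refine ⟨hdiff, ?_⟩
  rw [hdiff.hasDerivAt.ofReal_comp.unique hderiv]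
  exact (Summable.of_norm_bounded (hc.div_const ρ) fun l => hbound l x).hasSum

theorem APNormLE.differentiable (hω : ∀ i, |ω i| ≤ 1) (hρ : 0 < ρ) (hu : APNormLE ω ρ K u) :
    Differentiable ℝ u := by
  obtain ⟨c, hc, -, hsum⟩ := hu.series
  exact fun x => (hasSum_deriv_of_hasSum_lineChar hω hρ hc hsum x).1

protected theorem APNormLE.deriv (hω : ∀ i, |ω i| ≤ 1) (hρ : 0 ≤ ρ) (hσ : 0 < σ)
    (hu : APNormLE ω (ρ + σ) K u) : APNormLE ω ρ (K / σ) (deriv u) := by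
  obtain ⟨c, hc, hcK, hsum⟩ := hu.series
  refine ⟨hρ, .of_coeff_le (c := fun l => c l * (Complex.I * pairing ω l))
    (k := fun l => ‖c l‖ * lineWeight (ρ + σ) l / σ) (fun l => (lineWeight_pos ρ l).le)
    (fun l => ?_) (hc.div_const σ) ?_
    fun x => (hasSum_deriv_of_hasSum_lineChar hω (by positivity) hc hsum x).2⟩
  · calc ‖c l * (Complex.I * pairing ω l)‖ * lineWeight ρ l
        ≤ ‖c l‖ * (lineWeight σ l / σ) * lineWeight ρ l := by
          rw [norm_mul]
          have hW := (lineWeight_pos ρ l).le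
          gcongr
          exact (norm_I_mul_pairing_le hω l).trans (wlen_le_exp_div hσ l)
      _ = ‖c l‖ * lineWeight (ρ + σ) l / σ := by
          rw [lineWeight, lineWeight, lineWeight, add_mul, Real.exp_add]
          ring
  · rw [tsum_div_const]
    gcongr

/-- The partial derivative in the first variable, with the junk value of `deriv`. -/
noncomputable def partialX (F : ℝ → ℝ → ℝ) (x y : ℝ) : ℝ := deriv (fun x => F x y) x

/-- The partial derivative in the second variable, with the junk value of `deriv`. -/
noncomputable def partialY (F : ℝ → ℝ → ℝ) (x y : ℝ) : ℝ := deriv (F x) y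

theorem hasDerivAt_comp_pair {x' y' t : ℝ} {X Y : ℝ → ℝ}
    (hF : DifferentiableAt ℝ (Function.uncurry F) (X t, Y t))
    (hX : HasDerivAt X x' t) (hY : HasDerivAt Y y' t) :
    HasDerivAt (fun t => F (X t) (Y t))
      (partialX F (X t) (Y t) * x' + partialY F (X t) (Y t) * y') t := by
  set D := fderiv ℝ (Function.uncurry F) (X t, Y t)
  have hchain : ∀ {f g : ℝ → ℝ} {f' g' z : ℝ}, f z = X t → g z = Y t → HasDerivAt f f' z →
      HasDerivAt g g' z → HasDerivAt (fun z => F (f z) (g z)) (D (f', g')) z := by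
    intro f g f' g' z hfz hgz hf hg
    have hD : HasFDerivAt (Function.uncurry F) D (f z, g z) := by
      rw [hfz, hgz]
      exact hF.hasFDerivAt
    exact hD.comp_hasDerivAt (f := fun z => (f z, g z)) z (hf.prodMk hg)
  have hDx : partialX F (X t) (Y t) = D (1, 0) :=
    (hchain (f := fun z => z) (g := fun _ => Y t) rfl rfl (hasDerivAt_id' _)
      (hasDerivAt_const _ _)).deriv
  have hDy : partialY F (X t) (Y t) = D (0, 1) :=
    (hchain (f := fun _ => X t) (g := fun z => z) rfl rfl (hasDerivAt_const _ _)
      (hasDerivAt_id' _)).deriv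
  have hsplit : D (x', y') = D (1, 0) * x' + D (0, 1) * y' := by
    have hxy : ((x', y') : ℝ × ℝ) = x' • (1, 0) + y' • (0, 1) := by simp
    rw [hxy, map_add, map_smul, map_smul, smul_eq_mul, smul_eq_mul]
    ring
  rw [hDx, hDy, ← hsplit]
  exact hchain rfl rfl hX hY

theorem natCast_mul_pow_le {z t : ℝ} (hz : 0 ≤ z) (ht : 0 < t) (k : ℕ) :
    (k : ℝ) * z ^ (k - 1) ≤ (z + t) ^ k / t := by
  rw [le_div_iff₀ ht]
  induction k with
  | zero => simp
  | succ k ih =>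
    have hpow : z ^ k ≤ (z + t) ^ k := pow_le_pow_left₀ hz (by linarith) k
    have hz_mul : (k : ℝ) * z ^ k = k * z ^ (k - 1) * z := by
      cases k <;> simp [pow_succ, mul_assoc]
    calc ((k + 1 : ℕ) : ℝ) * z ^ (k + 1 - 1) * t
        = k * z ^ (k - 1) * t * z + z ^ k * t := by
          rw [Nat.add_sub_cancel, Nat.cast_succ, add_mul, hz_mul]
          ring
      _ ≤ (z + t) ^ k * z + (z + t) ^ k * t := by gcongr
      _ = (z + t) ^ (k + 1) := by ring

/-- The derivative of `(x, y) ↦ e ^ (i (ω, l) x) y ^ k`. -/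
noncomputable def bandTermDeriv (ω : ℕ+ → ℝ) (j : IntVec × ℕ) (x : ℝ × ℝ) : ℝ × ℝ →L[ℝ] ℂ :=
  (ContinuousLinearMap.fst ℝ ℝ ℝ).smulRight
      (Complex.I * pairing ω j.1 * expMode ω j.1 (x.1 : ℂ) * (x.2 : ℂ) ^ j.2)
    + (ContinuousLinearMap.snd ℝ ℝ ℝ).smulRight
      (expMode ω j.1 (x.1 : ℂ) * (j.2 * (x.2 : ℂ) ^ (j.2 - 1)))

theorem hasFDerivAt_bandTerm (j : IntVec × ℕ) (x : ℝ × ℝ) :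
    HasFDerivAt (fun x : ℝ × ℝ => expMode ω j.1 (x.1 : ℂ) * (x.2 : ℂ) ^ j.2)
      (bandTermDeriv ω j x) x := by
  have hfst := (hasDerivAt_expMode (ω := ω) j.1 x.1).hasFDerivAt.comp x
    (hasFDerivAt_fst (𝕜 := ℝ) (p := x))
  have hsnd := ((hasDerivAt_pow j.2 (x.2 : ℂ)).comp_ofReal).hasFDerivAt.comp x
    (hasFDerivAt_snd (𝕜 := ℝ) (p := x))
  refine (hfst.mul hsnd).congr_fderiv ?_
  ext <;> simp [bandTermDeriv, mul_comm]

theorem norm_bandTermDeriv_le (hω : ∀ i, |ω i| ≤ 1) (hr : 0 < r) {z t : ℝ} (ht : 0 < t)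
    (j : IntVec × ℕ) {x : ℝ × ℝ} (hx : |x.2| ≤ z) :
    ‖bandTermDeriv ω j x‖ ≤ bandWeight r (z + t) j * (1 / r + 1 / t) := by
  have hz : 0 ≤ z := (abs_nonneg _).trans hx
  have hdx : ‖Complex.I * pairing ω j.1 * expMode ω j.1 (x.1 : ℂ) * (x.2 : ℂ) ^ j.2‖
      ≤ lineWeight r j.1 / r * (z + t) ^ j.2 := by
    rw [norm_mul, norm_mul _ (expMode _ _ _), norm_expMode_real, mul_one, norm_pow,
      Complex.norm_real]
    exact mul_le_mul ((norm_I_mul_pairing_le hω j.1).trans (wlen_le_exp_div hr j.1))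
      (pow_le_pow_left₀ (abs_nonneg _) (hx.trans (by linarith)) _) (by positivity)
      (div_nonneg (lineWeight_pos r j.1).le hr.le)
  have hdy : ‖expMode ω j.1 (x.1 : ℂ) * (j.2 * (x.2 : ℂ) ^ (j.2 - 1))‖
      ≤ lineWeight r j.1 * ((z + t) ^ j.2 / t) := by
    rw [norm_mul, norm_expMode_real, one_mul, norm_mul, norm_pow, Complex.norm_real,
      Complex.norm_natCast]
    calc (j.2 : ℝ) * |x.2| ^ (j.2 - 1) ≤ j.2 * z ^ (j.2 - 1) := by gcongr
      _ ≤ (z + t) ^ j.2 / t := natCast_mul_pow_le hz ht j.2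
      _ ≤ lineWeight r j.1 * ((z + t) ^ j.2 / t) :=
          le_mul_of_one_le_left (by positivity) (one_le_lineWeight hr.le j.1)
  calc ‖bandTermDeriv ω j x‖
      ≤ 1 * (lineWeight r j.1 / r * (z + t) ^ j.2)
        + 1 * (lineWeight r j.1 * ((z + t) ^ j.2 / t)) := by
        refine (norm_add_le _ _).trans (add_le_add ?_ ?_)
        · rw [ContinuousLinearMap.norm_smulRight_apply]
          exact mul_le_mul (ContinuousLinearMap.norm_fst_le ℝ ℝ ℝ) hdx (norm_nonneg _) zero_le_one
        · rw [ContinuousLinearMap.norm_smulRight_apply]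
          exact mul_le_mul (ContinuousLinearMap.norm_snd_le ℝ ℝ ℝ) hdy (norm_nonneg _) zero_le_one
    _ = bandWeight r (z + t) j * (1 / r + 1 / t) := by
        rw [bandWeight]
        ring

theorem exists_hasFDerivAt_of_hasSum_bandChar (hω : ∀ i, |ω i| ≤ 1) (hr : 0 < r)
    {c : IntVec × ℕ → ℂ} (hc : Summable fun j => ‖c j‖ * bandWeight r s j)
    (hF : ∀ x, HasSum (fun j => c j * bandChar ω s j x) (F x.1 x.2 : ℂ)) {x y : ℝ}
    (hy : |y| < s) :
    ∃ D : ℝ × ℝ →L[ℝ] ℂ, HasFDerivAt (fun z : ℝ × ℝ => (F z.1 z.2 : ℂ)) D (x, y) ∧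
      HasSum (fun j => c j • bandTermDeriv ω j (x, y)) D := by
  obtain ⟨z, hyz, hzs⟩ := exists_between hy
  set S : Set (ℝ × ℝ) := Prod.snd ⁻¹' Metric.ball (0 : ℝ) z with hS
  have hSopen : IsOpen S := Metric.isOpen_ball.preimage continuous_snd
  have hSconv : Convex ℝ S := (convex_ball (0 : ℝ) z).linear_preimage (LinearMap.snd ℝ ℝ ℝ)
  have hSabs : ∀ p ∈ S, |p.2| < z := fun p hp => by simpa [hS] using hp
  have hxy : (x, y) ∈ S := by simpa [hS] using hyz
  have hsum : ∀ p ∈ S, HasSum (fun j => c j * (expMode ω j.1 (p.1 : ℂ) * (p.2 : ℂ) ^ j.2))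
      (F p.1 p.2 : ℂ) := fun p hp =>
    hF (p.1, ⟨p.2, abs_le.1 ((hSabs p hp).trans hzs).le⟩)
  have hbound : ∀ j, ∀ p ∈ S, ‖c j • bandTermDeriv ω j p‖
      ≤ ‖c j‖ * bandWeight r s j * (1 / r + 1 / (s - z)) := fun j p hp => by
    rw [norm_smul, mul_assoc]
    gcongr
    simpa using norm_bandTermDeriv_le hω hr (sub_pos.2 hzs) j (hSabs p hp).le
  have hmaj := hc.mul_right (1 / r + 1 / (s - z))
  have hderiv := hasFDerivAt_tsum_of_isPreconnected hmaj hSopen hSconv.isPreconnected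
    (fun j p _ => (hasFDerivAt_bandTerm (ω := ω) j p).const_mul (c j)) hbound hxy
    (hsum _ hxy).summable hxy
  refine ⟨_, hderiv.congr_of_eventuallyEq ?_,
    (Summable.of_norm_bounded hmaj fun j => hbound j _ hxy).hasSum⟩
  filter_upwards [hSopen.mem_nhds hxy] with p hp using (hsum p hp).tsum_eq.symm

theorem BandNormLE.differentiableAt (hω : ∀ i, |ω i| ≤ 1) (hr : 0 < r)
    (hF : BandNormLE ω r s K F) (x : ℝ) {y : ℝ} (hy : |y| < s) :
    DifferentiableAt ℝ (Function.uncurry F) (x, y) := by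
  obtain ⟨c, hc, -, hsum⟩ := hF.series
  obtain ⟨D, hD, -⟩ := exists_hasFDerivAt_of_hasSum_bandChar hω hr hc hsum (x := x) hy
  exact (Complex.reCLM.hasFDerivAt.comp (x, y) hD).differentiableAt

theorem hasSum_partialY_of_hasSum_bandChar (hω : ∀ i, |ω i| ≤ 1) (hr : 0 < r) {c : IntVec × ℕ → ℂ}
    (hc : Summable fun j => ‖c j‖ * bandWeight r s j)
    (hF : ∀ x, HasSum (fun j => c j * bandChar ω s j x) (F x.1 x.2 : ℂ)) (x : ℝ) {y : ℝ}
    (hy : |y| < s) :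
    HasSum (fun j => c j * (expMode ω j.1 (x : ℂ) * (j.2 * (y : ℂ) ^ (j.2 - 1))))
      (partialY F x y : ℂ) := by
  obtain ⟨D, hD, hsum⟩ := exists_hasFDerivAt_of_hasSum_bandChar hω hr hc hF (x := x) hy
  have hline : HasDerivAt (fun y => (F x y : ℂ)) (D (0, 1)) y :=
    hD.comp_hasDerivAt (f := fun y => (x, y)) y ((hasDerivAt_const y x).prodMk (hasDerivAt_id y))
  have hreal : HasDerivAt (F x) (D (0, 1)).re y :=
    Complex.reCLM.hasFDerivAt.comp_hasDerivAt y hline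
  rw [partialY, hreal.deriv, hreal.ofReal_comp.unique hline]
  simpa [bandTermDeriv] using (ContinuousLinearMap.apply ℝ ℂ ((0, 1) : ℝ × ℝ)).hasSum hsum

protected theorem BandNormLE.partialY {t : ℝ} (hω : ∀ i, |ω i| ≤ 1) (hr : 0 < r) (ht : 0 < t)
    (hts : t < s) (hF : BandNormLE ω r s K F) :
    BandNormLE ω r (s - t) (K / t) (partialY F) := by
  obtain ⟨c, hc, hcK, hsum⟩ := hF.series
  have hst : 0 < s - t := sub_pos.2 hts
  refine ⟨hr.le, hst, .hasSum (isCharSystem_band ω hr.le hst)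
    (f := fun j x => (c j * j.2) * bandChar ω (s - t) (j.1, j.2 - 1) x)
    (k := fun j => ‖c j‖ * bandWeight r s j / t) (fun j => (SeriesNormLE.single _ _).mono ?_)
    (hc.div_const t) ?_ fun x => ?_⟩
  · have hpow := natCast_mul_pow_le hst.le ht j.2
    rw [sub_add_cancel] at hpow
    calc ‖c j * j.2‖ * bandWeight r (s - t) (j.1, j.2 - 1)
        = ‖c j‖ * (lineWeight r j.1 * (j.2 * (s - t) ^ (j.2 - 1))) := by
          rw [norm_mul, Complex.norm_natCast, bandWeight]
          ring
      _ ≤ ‖c j‖ * (lineWeight r j.1 * (s ^ j.2 / t)) := by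
          have hW := (lineWeight_pos r j.1).le
          gcongr
      _ = ‖c j‖ * bandWeight r s j / t := by
          rw [bandWeight]
          ring
  · rw [tsum_div_const]
    gcongr
  · have hx : |(x.2 : ℝ)| < s := (abs_le.2 x.2.2).trans_lt (by linarith)
    refine (hasSum_partialY_of_hasSum_bandChar hω hr hc hsum x.1 hx).congr_fun fun j => ?_
    rw [bandChar]
    ring

end Derivatives

section Taylor

variable {ω : ℕ+ → ℝ} {ρ r s K A B a h : ℝ} {F : ℝ → ℝ → ℝ} {p v q w : ℝ → ℝ}

theorem APNormLE.of_hasSum_bandCoeff (hρ : 0 ≤ ρ) {R M : ℝ} {c : IntVec × ℕ → ℂ} {b : ℕ → ℝ}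
    {u : ℝ → ℝ} (hM : 0 ≤ M) (hc : Summable fun j => ‖c j‖ * bandWeight ρ R j)
    (hcK : ∑' j, ‖c j‖ * bandWeight ρ R j ≤ K) (hb : ∀ k, |b k| ≤ R ^ k * M)
    (hu : ∀ x, HasSum (fun j => c j * b j.2 * lineChar ω j.1 x) (u x : ℂ)) :
    APNormLE ω ρ (K * M) u := by
  refine ⟨hρ, .hasSum (isCharSystem_line ω hρ) (k := fun j => ‖c j‖ * bandWeight ρ R j * M)
    (fun j => (SeriesNormLE.single _ j.1).mono ?_) (hc.mul_right M) ?_ hu⟩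
  · rw [norm_mul, Complex.norm_real, Real.norm_eq_abs, bandWeight]
    have hW := (lineWeight_pos ρ j.1).le
    calc ‖c j‖ * |b j.2| * lineWeight ρ j.1 ≤ ‖c j‖ * (R ^ j.2 * M) * lineWeight ρ j.1 := by
          gcongr
          exact hb j.2
      _ = ‖c j‖ * (lineWeight ρ j.1 * R ^ j.2) * M := by ring
  · rw [tsum_mul_right]
    gcongr

theorem BandNormLE.value_one_sub_zero {R : ℝ} (hR : 1 ≤ R) (hF : BandNormLE ω ρ R K F) :
    APNormLE ω ρ (K / R) fun x => F x 1 - F x 0 := by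
  obtain ⟨c, hc, hcK, hsum⟩ := hF.series
  have hR0 : 0 < R := hF.height_pos
  rw [div_eq_mul_inv]
  refine .of_hasSum_bandCoeff hF.width_nonneg (b := fun k => 1 - 0 ^ k) (inv_pos.2 hR0).le hc hcK
    (fun k => ?_) fun x => ?_
  · rcases k with _ | k
    · simp [hR0.le]
    · simpa [pow_succ, hR0.ne'] using one_le_pow₀ hR
  · have hone := hsum (x, ⟨1, by linarith, hR⟩)
    have hzero := hsum (x, ⟨0, by linarith, hR0.le⟩)
    rw [Complex.ofReal_sub]
    refine (hone.sub hzero).congr_fun fun j => ?_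
    simp only [bandChar, lineChar]
    push_cast
    ring

theorem BandNormLE.value_one_sub_taylor (hω : ∀ i, |ω i| ≤ 1) (hρ : 0 < ρ) {R : ℝ} (hR : 1 ≤ R)
    (hF : BandNormLE ω ρ R K F) :
    APNormLE ω ρ (K / R ^ 2) fun x => F x 1 - F x 0 - partialY F x 0 := by
  obtain ⟨c, hc, hcK, hsum⟩ := hF.series
  have hR0 : 0 < R := hF.height_pos
  rw [div_eq_mul_inv]
  refine .of_hasSum_bandCoeff hρ.le (b := fun k => 1 - 0 ^ k - k * 0 ^ (k - 1))
    (inv_pos.2 (pow_pos hR0 2)).le hc hcK (fun k => ?_) fun x => ?_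
  · rcases k with _ | _ | k
    · simp [hR0.le]
    · simpa using by positivity
    · have hcancel : R ^ (k + 2) * (R ^ 2)⁻¹ = R ^ k := by
        rw [pow_add, mul_inv_cancel_right₀ (pow_pos hR0 2).ne']
      simpa [hcancel] using one_le_pow₀ hR
  · have hone := hsum (x, ⟨1, by linarith, hR⟩)
    have hzero := hsum (x, ⟨0, by linarith, hR0.le⟩)
    have hderiv := hasSum_partialY_of_hasSum_bandChar hω hρ hc hsum x (y := 0) (by simpa)
    rw [Complex.ofReal_sub, Complex.ofReal_sub]
    refine ((hone.sub hzero).sub hderiv).congr_fun fun j => ?_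
    simp only [bandChar, lineChar]
    push_cast
    ring

theorem BandNormLE.increment (hω : ∀ i, |ω i| ≤ 1) (hF : BandNormLE ω r s K F)
    (hp : APNormLE ω ρ A p) (hv : APNormLE ω ρ B v) (hq : APNormLE ω ρ a q)
    (hw : APNormLE ω ρ a w) (ha : 0 < a) (hah : a ≤ h) (hr : ρ + A + h ≤ r) (hs : B + h ≤ s) :
    APNormLE ω ρ (K * (a / h)) fun x => F (x + (p x + q x)) (v x + w x) - F (x + p x) (v x) := by
  have hseg := hF.segment hω hp hv hq hw ha (ha.trans_le hah) hr hs
  refine ((hseg.value_one_sub_zero ((one_le_div ha).2 hah)).mono (le_of_eq ?_)).congr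
    fun x => by simp
  rw [div_div_eq_mul_div, mul_div_assoc]

theorem BandNormLE.remainder (hω : ∀ i, |ω i| ≤ 1) (hρ : 0 < ρ) (hF : BandNormLE ω r s K F)
    (hp : APNormLE ω ρ A p) (hv : APNormLE ω ρ B v) (hq : APNormLE ω ρ a q)
    (hw : APNormLE ω ρ a w) (ha : 0 < a) (hah : a ≤ h) (hr : ρ + A + h ≤ r) (hs : B + h ≤ s) :
    APNormLE ω ρ (K * (a / h) ^ 2) fun x =>
      F (x + (p x + q x)) (v x + w x) - F (x + p x) (v x)
        - (partialX F (x + p x) (v x) * q x + partialY F (x + p x) (v x) * w x) := by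
  have hh : 0 < h := ha.trans_le hah
  have hseg := hF.segment hω hp hv hq hw ha hh hr hs
  refine ((hseg.value_one_sub_taylor hω hρ ((one_le_div ha).2 hah)).mono (le_of_eq ?_)).congr
    fun x => ?_
  · rw [div_pow, div_pow, div_div_eq_mul_div, mul_div_assoc]
  · have hline : ∀ b d : ℝ, HasDerivAt (fun t => b + t * d) d 0 := fun b d => by
      simpa using ((hasDerivAt_id (0 : ℝ)).mul_const d).const_add b
    have hdiff : DifferentiableAt ℝ (Function.uncurry F)
        (x + (p x + 0 * q x), v x + 0 * w x) := by
      refine hF.differentiableAt hω (by linarith [hp.nonneg]) _ ?_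
      rw [zero_mul, add_zero]
      linarith [hv.abs_le x]
    have hderiv := (hasDerivAt_comp_pair (X := fun t => x + (p x + t * q x))
      (Y := fun t => v x + t * w x) hdiff ((hline _ _).const_add x) (hline _ _)).deriv
    simp only [zero_mul, add_zero] at hderiv
    simp [partialY, hderiv]

end Taylor

section Cohomological

variable {ω : ℕ+ → ℝ} {ρ σ K β Γ : ℝ}

/-- The small divisors of the operators `U ↦ U (· + β) - κ U`, `0 ≤ κ`, away from the mean value
lose at most the factor `Γ` and the width `σ`. -/
def DivisorEstimate (ω : ℕ+ → ℝ) (β σ Γ : ℝ) : Prop :=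
  ∀ κ : ℝ, 0 ≤ κ → ∀ l : IntVec, l ≠ 0 →
    Real.exp (-(σ * wlen l)) ≤ Γ * ‖expMode ω l (β : ℂ) - (κ : ℂ)‖

theorem DivisorEstimate.sub_ne_zero (hdiv : DivisorEstimate ω β σ Γ) {κ : ℝ} (hκ : 0 ≤ κ)
    {l : IntVec} (hl : l ≠ 0) : expMode ω l (β : ℂ) - κ ≠ 0 := fun h0 => by
  have hbound := hdiv κ hκ l hl
  rw [h0, norm_zero, mul_zero] at hbound
  exact absurd hbound (not_le.2 (Real.exp_pos _))

theorem DivisorEstimate.lineWeight_div_le (hdiv : DivisorEstimate ω β σ Γ) {κ : ℝ} (hκ : 0 ≤ κ)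
    {l : IntVec} (hl : l ≠ 0) :
    lineWeight ρ l / ‖expMode ω l (β : ℂ) - κ‖ ≤ Γ * lineWeight (ρ + σ) l := by
  rw [div_le_iff₀ (norm_pos_iff.2 (hdiv.sub_ne_zero hκ hl))]
  calc lineWeight ρ l = lineWeight (ρ + σ) l * Real.exp (-(σ * wlen l)) := by
        rw [lineWeight, lineWeight, ← Real.exp_add]
        ring_nf
    _ ≤ lineWeight (ρ + σ) l * (Γ * ‖expMode ω l (β : ℂ) - κ‖) :=
        mul_le_mul_of_nonneg_left (hdiv κ hκ l hl) (lineWeight_pos _ _).le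
    _ = Γ * lineWeight (ρ + σ) l * ‖expMode ω l (β : ℂ) - κ‖ := by ring

theorem APNormLE.exists_cohomological_solution (hρ : 0 ≤ ρ) {u : ℝ → ℝ}
    (hdiv : DivisorEstimate ω β σ Γ) {κ : ℝ} (hκ : 0 ≤ κ) (hΓ : 0 ≤ Γ)
    (hu : APNormLE ω (ρ + σ) K u) :
    ∃ (U : ℝ → ℝ) (C : ℝ), |C| ≤ K ∧ APNormLE ω ρ (Γ * K) U ∧
      ∀ x, U (x + β) - κ * U x = u x - C := by
  classical
  obtain ⟨c, hc, hcK, hsum⟩ := hu.series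
  set d : IntVec → ℂ := fun l => if l = 0 then 0 else c l / (expMode ω l (β : ℂ) - κ) with hd
  have hdc : ∀ l, ‖d l‖ * lineWeight ρ l ≤ Γ * (‖c l‖ * lineWeight (ρ + σ) l) := fun l => by
    rcases eq_or_ne l 0 with rfl | hl
    · have hW := (lineWeight_pos (ρ + σ) 0).le
      simpa [hd] using by positivity
    · simp only [hd, if_neg hl, norm_div]
      calc ‖c l‖ / ‖expMode ω l (β : ℂ) - κ‖ * lineWeight ρ l
          = ‖c l‖ * (lineWeight ρ l / ‖expMode ω l (β : ℂ) - κ‖) := by ring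
        _ ≤ ‖c l‖ * (Γ * lineWeight (ρ + σ) l) := by
            gcongr
            exact hdiv.lineWeight_div_le hκ hl
        _ = Γ * (‖c l‖ * lineWeight (ρ + σ) l) := by ring
  have hS := isCharSystem_line ω hρ
  have hdsum : ∀ x, HasSum (fun l => d l * lineChar ω l x) (∑' l, d l * lineChar ω l x) :=
    fun x => (hS.summable_of_coeff_le hdc (hc.mul_left Γ) x).hasSum
  have hU : SeriesNormLE (lineChar ω) (lineWeight ρ) (Γ * K)
      fun x => ∑' l, d l * lineChar ω l x := by
    refine .of_coeff_le (fun l => (lineWeight_pos ρ l).le) hdc (hc.mul_left Γ) ?_ hdsum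
    rw [tsum_mul_left]
    gcongr
  refine ⟨_, (c 0).re, ?_, ⟨hρ, hU.re hS⟩, fun x => ?_⟩
  · refine (Complex.abs_re_le_norm _).trans (le_trans ?_ hcK)
    simpa [lineWeight, wlen_zero] using
      hc.le_tsum 0 fun l _ => mul_nonneg (norm_nonneg _) (lineWeight_pos _ _).le
  · have hmean := (hsum x).sub (hasSum_single (f := fun l : IntVec => if l = 0 then c 0 else 0) 0
      fun l hl => by simp [hl])
    have hshift := (hdsum (x + β)).sub ((hdsum x).mul_left (κ : ℂ))
    have hcoeff : ∀ l, d l * lineChar ω l (x + β) - κ * (d l * lineChar ω l x)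
        = c l * lineChar ω l x - if l = 0 then c 0 else 0 := fun l => by
      rcases eq_or_ne l 0 with rfl | hl
      · simp [hd, lineChar, expMode_zero]
      · have hne : expMode ω l (β : ℂ) - κ ≠ 0 := hdiv.sub_ne_zero hκ hl
        simp only [hd, if_neg hl, lineChar, Complex.ofReal_add, expMode_arg_add]
        field_simp
        ring
    simpa using congrArg Complex.re ((hshift.congr_fun fun l => (hcoeff l).symm).unique hmean)

end Cohomological

section SmallDivisors

variable {ω : ℕ+ → ℝ}

theorem dioProd_pos (τ : ℝ) (l : IntVec) : 0 < dioProd τ l :=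
  Finset.prod_pos fun _ _ => by positivity

theorem one_add_rpow_le_exp_sqrt {τ t : ℝ} (hτ : 0 ≤ τ) (ht : 1 ≤ t) :
    1 + t ^ τ ≤ Real.exp ((1 + 2 * τ) * √t) := by
  have hsqrt : 1 ≤ √t := Real.one_le_sqrt.2 ht
  have hpow : t ^ τ ≤ Real.exp (2 * τ * √t) := by
    rw [Real.rpow_def_of_pos (by linarith), Real.exp_le_exp]
    have hlog : Real.log t = 2 * Real.log √t := by
      rw [Real.log_sqrt (by linarith)]
      ring
    have hle : Real.log √t ≤ √t := (Real.log_le_sub_one_of_pos (by linarith)).trans (by linarith)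
    rw [hlog]
    nlinarith
  calc 1 + t ^ τ ≤ 2 * t ^ τ := by linarith [Real.one_le_rpow ht hτ]
    _ ≤ Real.exp √t * Real.exp (2 * τ * √t) := by
        gcongr
        linarith [Real.add_one_le_exp √t]
    _ = Real.exp ((1 + 2 * τ) * √t) := by
        rw [← Real.exp_add]
        ring_nf

-- The factor is absorbed by `e ^ (σ t)` as soon as `√t` exceeds `A / σ`.
theorem one_add_rpow_le_exp {τ σ t A : ℝ} (hτ : 0 ≤ τ) (hσ : 0 < σ) (ht : 1 ≤ t)
    (hA : A = 1 + 2 * τ) {P : Prop} [Decidable P] (hP : t < (A / σ) ^ 2 → P) :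
    1 + t ^ τ ≤ Real.exp (σ * t + if P then A ^ 2 / σ else 0) := by
  have hA0 : 0 < A := by rw [hA]; positivity
  have ht0 : 0 ≤ t := by linarith
  refine (one_add_rpow_le_exp_sqrt hτ ht).trans (Real.exp_le_exp.2 ?_)
  rw [← hA]
  rcases le_or_gt (A / σ) √t with hlarge | hsmall
  · calc A * √t ≤ σ * √t * √t := by
          gcongr
          rwa [div_le_iff₀' hσ] at hlarge
      _ = σ * t := by rw [mul_assoc, Real.mul_self_sqrt ht0]
      _ ≤ σ * t + if P then A ^ 2 / σ else 0 := by
          refine le_add_of_nonneg_right ?_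
          split_ifs <;> positivity
  · rw [if_pos (hP ((Real.sqrt_lt' (by positivity)).1 hsmall))]
    calc A * √t ≤ A * (A / σ) := by gcongr
      _ = A ^ 2 / σ := by ring
      _ ≤ σ * t + A ^ 2 / σ := le_add_of_nonneg_left (by positivity)

theorem card_filter_coe_lt_le {T : ℝ} (hT : 0 ≤ T) (s : Finset ℕ+) :
    ((s.filter fun i : ℕ+ => ((i : ℕ) : ℝ) < T).card : ℝ) ≤ T := by
  have hcard : (s.filter fun i : ℕ+ => ((i : ℕ) : ℝ) < T).card ≤ (Finset.Icc 1 ⌊T⌋₊).card := by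
    refine Finset.card_le_card_of_injOn (fun i : ℕ+ => (i : ℕ)) (fun i hi => ?_)
      fun i _ j _ h => PNat.coe_injective h
    have hiT := (Finset.mem_filter.1 (Finset.mem_coe.1 hi)).2
    exact Finset.mem_coe.2 (Finset.mem_Icc.2 ⟨i.pos, Nat.le_floor hiT.le⟩)
  rw [Nat.card_Icc, Nat.add_sub_cancel] at hcard
  exact (Nat.cast_le.2 hcard).trans (Nat.floor_le hT)

theorem dioProd_le_exp {τ σ : ℝ} (hτ : 0 ≤ τ) (hσ : 0 < σ) (l : IntVec) :
    dioProd τ l ≤ Real.exp (σ * wlen l + (1 + 2 * τ) ^ 4 / σ ^ 3) := by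
  classical
  obtain ⟨A, hA⟩ : ∃ A, A = 1 + 2 * τ := ⟨_, rfl⟩
  set T := (A / σ) ^ 2 with hT
  have hfactor : ∀ i ∈ l.support, 1 + ((i : ℕ) : ℝ) ^ τ * |(l i : ℝ)| ^ τ
      ≤ Real.exp (σ * (|(l i : ℝ)| * ((i : ℕ) : ℝ))
        + if ((i : ℕ) : ℝ) < T then A ^ 2 / σ else 0) := fun i hi => by
    have hli : (1 : ℝ) ≤ |(l i : ℝ)| := by
      exact_mod_cast Int.one_le_abs (Finsupp.mem_support_iff.1 hi)
    have hi1 : (1 : ℝ) ≤ ((i : ℕ) : ℝ) := by exact_mod_cast i.pos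
    rw [← Real.mul_rpow (by positivity) (abs_nonneg _), mul_comm ((i : ℕ) : ℝ)]
    exact one_add_rpow_le_exp hτ hσ (one_le_mul_of_one_le_of_one_le hli hi1) hA
      (le_mul_of_one_le_left (by linarith) hli).trans_lt
  calc dioProd τ l ≤ ∏ i ∈ l.support, Real.exp (σ * (|(l i : ℝ)| * ((i : ℕ) : ℝ))
          + if ((i : ℕ) : ℝ) < T then A ^ 2 / σ else 0) :=
        Finset.prod_le_prod (fun i _ => by positivity) hfactor
    _ = Real.exp (σ * wlen l
          + (l.support.filter fun i : ℕ+ => ((i : ℕ) : ℝ) < T).card * (A ^ 2 / σ)) := by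
        rw [← Real.exp_sum, Finset.sum_add_distrib, ← Finset.mul_sum, ← Finset.sum_filter,
          Finset.sum_const, nsmul_eq_mul]
        rfl
    _ ≤ Real.exp (σ * wlen l + T * (A ^ 2 / σ)) := by
        gcongr
        exact card_filter_coe_lt_le (by positivity) _
    _ = Real.exp (σ * wlen l + (1 + 2 * τ) ^ 4 / σ ^ 3) := by
        rw [← hA, hT]
        field_simp

theorem four_mul_abs_le_two_mul_abs_sin {y : ℝ} (hy : |y| ≤ 1 / 2) :
    4 * |y| ≤ 2 * |Real.sin (Real.pi * y)| := by
  have hpi := Real.pi_pos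
  have hsin := Real.mul_abs_le_abs_sin (x := Real.pi * y) (by
    rw [abs_mul, abs_of_pos hpi]
    nlinarith)
  rw [abs_mul, abs_of_pos hpi, ← mul_assoc, div_mul_cancel₀ _ hpi.ne'] at hsin
  linarith

theorem norm_expMode_real_sub_one (l : IntVec) (β : ℝ) :
    ‖expMode ω l (β : ℂ) - 1‖ = 2 * |Real.sin (pairing ω l * β / 2)| := by
  have hexp : expMode ω l (β : ℂ) = Complex.exp (Complex.I * ((pairing ω l * β : ℝ) : ℂ)) := by
    rw [expMode]
    push_cast
    ring_nf
  rw [hexp, Complex.norm_exp_I_mul_ofReal_sub_one]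
  simp

-- Among the nonnegative reals, `|κ - 1| = ||κ| - |z|| ≤ |z - κ|` for `|z| = 1`.
theorem norm_expMode_real_sub_one_le {κ : ℝ} (hκ : 0 ≤ κ) (l : IntVec) (β : ℝ) :
    ‖expMode ω l (β : ℂ) - 1‖ ≤ 2 * ‖expMode ω l (β : ℂ) - (κ : ℂ)‖ := by
  have htriangle := norm_sub_le_norm_sub_add_norm_sub (expMode ω l (β : ℂ)) (κ : ℂ) 1
  have hreverse := abs_norm_sub_norm_le (expMode ω l (β : ℂ)) (κ : ℂ)
  have hnorm : ‖(κ : ℂ) - 1‖ = |κ - 1| := by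
    rw [← Complex.ofReal_one, ← Complex.ofReal_sub, Complex.norm_real, Real.norm_eq_abs]
  rw [norm_expMode_real, Complex.norm_of_nonneg hκ, abs_sub_comm] at hreverse
  linarith

theorem IsNonresonant.le_norm_sub {γ μ β κ : ℝ} (h : IsNonresonant ω γ μ β) (hκ : 0 ≤ κ)
    {l : IntVec} (hl : l ≠ 0) :
    2 * (γ / dioProd (2 + 2 * μ) l) ≤ ‖expMode ω l (β : ℂ) - (κ : ℂ)‖ := by
  set x := pairing ω l * (β / (2 * Real.pi)) with hx
  have hsin : |Real.sin (Real.pi * (x - round x))| = |Real.sin (pairing ω l * β / 2)| := by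
    have harg : Real.pi * (x - round x) = pairing ω l * β / 2 - round x * Real.pi := by
      rw [hx]
      field_simp
    rw [harg, Real.sin_sub_int_mul_pi, abs_mul, abs_zpow, abs_neg, abs_one, one_zpow, one_mul]
  have hround := four_mul_abs_le_two_mul_abs_sin (abs_sub_round x)
  rw [hsin, ← norm_expMode_real_sub_one] at hround
  linarith [h l hl (round x), norm_expMode_real_sub_one_le (ω := ω) hκ l β]

/-- The factor lost to the small divisors when the strip shrinks by `σ`. -/
noncomputable def divisorBound (γ μ σ : ℝ) : ℝ :=
  (1 + 1 / (2 * γ)) * Real.exp (((5 + 4 * μ) ^ 4 + 1) / σ ^ 3)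

theorem IsNonresonant.divisorEstimate {γ μ β σ : ℝ} (h : IsNonresonant ω γ μ β) (hγ : 0 < γ)
    (hμ : -1 < μ) (hσ : 0 < σ) : DivisorEstimate ω β σ (divisorBound γ μ σ) := by
  intro κ hκ l hl
  have hD := dioProd_pos (2 + 2 * μ) l
  set E := Real.exp (((5 + 4 * μ) ^ 4 + 1) / σ ^ 3) with hE
  have hprod : dioProd (2 + 2 * μ) l ≤ Real.exp (σ * wlen l) * E := by
    rw [hE, ← Real.exp_add]
    refine (dioProd_le_exp (by linarith) hσ l).trans (Real.exp_le_exp.2 ?_)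
    rw [show 1 + 2 * (2 + 2 * μ) = 5 + 4 * μ by ring]
    gcongr
    linarith
  calc Real.exp (-(σ * wlen l)) ≤ E / dioProd (2 + 2 * μ) l := by
        rwa [Real.exp_neg, inv_eq_one_div, div_le_div_iff₀ (Real.exp_pos _) hD, one_mul,
          mul_comm E]
    _ ≤ (1 + 2 * γ) * (E / dioProd (2 + 2 * μ) l) :=
        le_mul_of_one_le_left (by positivity) (by linarith)
    _ = divisorBound γ μ σ * (2 * (γ / dioProd (2 + 2 * μ) l)) := by
        rw [divisorBound, ← hE]
        field_simp
        ring
    _ ≤ divisorBound γ μ σ * ‖expMode ω l (β : ℂ) - (κ : ℂ)‖ :=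
        mul_le_mul_of_nonneg_left (h.le_norm_sub hκ hl) (by rw [divisorBound]; positivity)

theorem one_div_le_divisorBound {γ μ σ : ℝ} (hγ : 0 < γ) (hσ : 0 < σ) (hσ1 : σ ≤ 1) :
    1 / σ ≤ divisorBound γ μ σ := by
  have hγ' : 0 < 1 / (2 * γ) := by positivity
  calc 1 / σ ≤ 1 / σ ^ 3 := by
        gcongr
        exact pow_le_of_le_one hσ.le hσ1 three_ne_zero
    _ ≤ ((5 + 4 * μ) ^ 4 + 1) / σ ^ 3 := by
        gcongr
        exact le_add_of_nonneg_left (by positivity)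
    _ ≤ Real.exp (((5 + 4 * μ) ^ 4 + 1) / σ ^ 3) := by
        linarith [Real.add_one_le_exp (((5 + 4 * μ) ^ 4 + 1) / σ ^ 3)]
    _ ≤ divisorBound γ μ σ := le_mul_of_one_le_left (Real.exp_pos _).le (by linarith)

theorem one_le_divisorBound {γ μ σ : ℝ} (hγ : 0 < γ) (hσ : 0 < σ) (hσ1 : σ ≤ 1) :
    1 ≤ divisorBound γ μ σ :=
  ((one_le_div hσ).2 hσ1).trans (one_div_le_divisorBound hγ hσ hσ1)

end SmallDivisors

section Inverse

variable {ω : ℕ+ → ℝ} {ρ A K : ℝ} {p u : ℝ → ℝ}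

/-- The Picard iterates for the equation `χ x + p (x + χ x) = 0`, whose solution `χ` makes
`x ↦ x + χ x` the inverse of `x ↦ x + p x`. -/
noncomputable def inverseIterate (p : ℝ → ℝ) : ℕ → ℝ → ℝ
  | 0, _ => 0
  | n + 1, x => -p (x + inverseIterate p n x)

protected theorem APNormLE.inverseIterate (hω : ∀ i, |ω i| ≤ 1) (hp : APNormLE ω ρ A p)
    (hA : A ≤ ρ / 8) (n : ℕ) : APNormLE ω (ρ / 2) (ρ / 8) (inverseIterate p n) := by
  have hρ := hp.width_nonneg
  induction n with
  | zero => exact (zero (by linarith)).mono (by linarith)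
  | succ n ih => exact ((hp.mono hA).comp_shift hω ih (by linarith)).neg

theorem APNormLE.inverseIterate_succ_sub (hω : ∀ i, |ω i| ≤ 1) (hρ : 0 < ρ)
    (hp : APNormLE ω ρ A p) (hA : A ≤ ρ / 8) (n : ℕ) :
    APNormLE ω (ρ / 2) (ρ / 8 * (1 / 2) ^ n) fun x =>
      inverseIterate p (n + 1) x - inverseIterate p n x := by
  have hzero : APNormLE ω (ρ / 2) 0 fun _ => 0 := zero (by linarith)
  induction n with
  | zero => exact ((hp.inverseIterate hω hA 1).sub hzero).mono (by simp)
  | succ n ih =>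
    have hpow : (1 / 2 : ℝ) ^ n ≤ 1 := pow_le_one₀ (by norm_num) (by norm_num)
    have hdiff := ((hp.mono hA).toBand hρ).increment hω (hp.inverseIterate hω hA n) hzero ih
      (hzero.mono (by positivity)) (h := ρ / 4) (by positivity) (by nlinarith) (by linarith)
      (by linarith)
    refine (hdiff.neg.mono (le_of_eq ?_)).congr fun x => ?_
    · field_simp
      ring
    · simp only [inverseIterate]
      ring_nf

theorem APNormLE.exists_inverse (hω : ∀ i, |ω i| ≤ 1) (hρ : 0 < ρ) (hp : APNormLE ω ρ A p)
    (hA : A ≤ ρ / 8) :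
    ∃ χ : ℝ → ℝ, APNormLE ω (ρ / 2) (ρ / 4) χ ∧ ∀ x, χ x + p (x + χ x) = 0 := by
  obtain ⟨χ, hχ, hlim⟩ := exists_limit (zero (by linarith))
    (hp.inverseIterate_succ_sub hω hρ hA)
    ((summable_geometric_of_lt_one (by norm_num) (by norm_num)).mul_left (ρ / 8))
  refine ⟨χ, hχ.mono (le_of_eq ?_), fun x => ?_⟩
  · rw [tsum_mul_left, tsum_geometric_two]
    ring
  · have hsucc := (Filter.tendsto_add_atTop_iff_nat 1).2 (hlim x)
    have hstep : Filter.Tendsto (fun n => -p (x + inverseIterate p n x)) Filter.atTop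
        (nhds (-p (x + χ x))) :=
      (((hp.differentiable hω hρ).continuous.tendsto _).comp ((hlim x).const_add x)).neg
    linarith [tendsto_nhds_unique hsucc hstep]

theorem APNormLE.memRealAP (hω : ∀ i, |ω i| ≤ 1) (hρ : 0 < ρ) (hu : APNormLE ω ρ K u) :
    MemRealAP ω u := by
  obtain ⟨c, hc, -, hsum⟩ := hu.series
  have hstrip (z : ℂ) (hz : |z.im| < ρ) : Summable fun l => c l * expMode ω l z := by
    refine Summable.of_norm_bounded hc fun l => ?_
    rw [norm_mul, norm_expMode, lineWeight]
    refine mul_le_mul_of_nonneg_left (Real.exp_le_exp.2 ?_) (norm_nonneg _)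
    calc -(pairing ω l * z.im) ≤ |pairing ω l| * |z.im| := by
          rw [← abs_mul]; exact neg_le_abs _
      _ ≤ wlen l * ρ :=
          mul_le_mul (abs_pairing_le_wlen hω l) hz.le (abs_nonneg _) (wlen_nonneg l)
      _ = _ := mul_comm _ _
  exact ⟨ρ, hρ, fun z => ∑' l, c l * expMode ω l z,
    ⟨c, by simpa only [lineWeight] using hc, fun z hz => (hstrip z hz).hasSum⟩,
    fun x => (hsum x).tsum_eq⟩

theorem APNormLE.abs_sub_le (hω : ∀ i, |ω i| ≤ 1) (hρ : 0 < ρ) (hu : APNormLE ω ρ K u)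
    (x y : ℝ) : |u x - u y| ≤ K / ρ * |x - y| :=
  convex_univ.norm_image_sub_le_of_norm_deriv_le (fun x _ => hu.differentiable hω hρ x)
    (fun x _ => (APNormLE.deriv hω le_rfl hρ (by rwa [zero_add])).abs_le x)
    (Set.mem_univ y) (Set.mem_univ x)

end Inverse

section Intersection

variable {ω : ℕ+ → ℝ} {ρ c δ α η : ℝ} {F G : ℝ → ℝ → ℝ}

/-- The horizontal defect of the curve `ξ ↦ (ξ + δ p(ξ), α + v(ξ))`, divided by `δ`: it vanishes
if and only if the mapping with `f(x, α + y) = δ F(x, y)` takes the point with parameter `x` to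
a point with the abscissa of the point with parameter `x + β`, where `β = δ α`. -/
def errX (β δ : ℝ) (F : ℝ → ℝ → ℝ) (p v : ℝ → ℝ) (x : ℝ) : ℝ :=
  p (x + β) - p x - v x - F (x + δ * p x) (v x)

/-- The vertical defect of the curve `ξ ↦ (ξ + δ p(ξ), α + v(ξ))` under the mapping with
`g(x, α + y) = G(x, y)`. -/
def errY (β δ : ℝ) (G : ℝ → ℝ → ℝ) (p v : ℝ → ℝ) (x : ℝ) : ℝ :=
  v (x + β) - v x - G (x + δ * p x) (v x)

/-- The quantitative form of the intersection property: on every curve of size at most `c` the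
vertical defect is dominated by the horizontal one at some point. -/
def IntersectionEstimate (ω : ℕ+ → ℝ) (β δ : ℝ) (F G : ℝ → ℝ → ℝ) (ρ c : ℝ) : Prop :=
  ∀ p v : ℝ → ℝ, APNormLE ω ρ c p → APNormLE ω ρ c v →
    ∃ x, |errY β δ G p v x| ≤ |errX β δ F p v x|

theorem exists_memRealAP_graph (hω : ∀ i, |ω i| ≤ 1) (hρ : 0 < ρ) {p v : ℝ → ℝ}
    (hp : APNormLE ω ρ c p) (hv : APNormLE ω ρ c v) (hc : c ≤ ρ / 8) :
    ∃ χ u : ℝ → ℝ, MemRealAP ω u ∧ (∀ x, χ x + p (x + χ x) = 0) ∧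
      ∀ x, u x = α + v (x + χ x) := by
  obtain ⟨χ, hχ, hinv⟩ := hp.exists_inverse hω hρ hc
  have hu := (APNormLE.const (by linarith) α).add (hv.comp_shift hω hχ (by linarith))
  exact ⟨χ, _, hu.memRealAP hω (by linarith), hinv, fun x => rfl⟩

theorem HasIntersectionProperty.exists_parameters {a b : ℝ} {f g : ℂ → ℂ → ℂ}
    (h : HasIntersectionProperty ω a b (twistMap δ f g)) (hω : ∀ i, |ω i| ≤ 1)
    (hδ : 0 < δ) (hδ1 : δ < 1) (hα : α ∈ Set.Icc (a + η) (b - η))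
    (hF : ∀ x y : ℝ, |y| ≤ η → (f (x : ℂ) ((α + y : ℝ) : ℂ)).re = δ * F x y)
    (hG : ∀ x y : ℝ, |y| ≤ η → (g (x : ℂ) ((α + y : ℝ) : ℂ)).re = G x y)
    (hρ : 0 < ρ) (hcρ : c ≤ ρ / 8) (hcη : c ≤ η) {p v : ℝ → ℝ} (hp : APNormLE ω ρ c p)
    (hv : APNormLE ω ρ c v) :
    ∃ ξ ζ, ζ + δ * p ζ = ξ + δ * p ξ + δ * (α + v ξ) + δ * F (ξ + δ * p ξ) (v ξ) ∧
      v ζ = v ξ + G (ξ + δ * p ξ) (v ξ) := by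
  have hδp : APNormLE ω ρ c fun x => δ * p x :=
    (hp.const_mul δ).mono (by rw [abs_of_pos hδ]; nlinarith [hp.nonneg])
  have hvη (x : ℝ) : |v x| ≤ η := (hv.abs_le x).trans hcη
  obtain ⟨χ, u, hu, hinv, hgraph⟩ := exists_memRealAP_graph (α := α) hω hρ hδp hv hcρ
  have hmem (x : ℝ) : u x ∈ Set.Icc a b := by
    have := abs_le.1 (hvη (x + χ x))
    rw [hgraph]
    constructor <;> linarith [hα.1, hα.2]
  obtain ⟨-, ⟨-, ⟨x, rfl⟩, rfl⟩, y, hy⟩ := h u hu hmem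
  obtain ⟨hfst, hsnd⟩ := Prod.ext_iff.1 hy
  simp only [twistMap, hgraph] at hfst hsnd
  rw [hF _ _ (hvη _)] at hfst
  rw [hG _ _ (hvη _)] at hsnd
  have hx : x + χ x + δ * p (x + χ x) = x := by linarith [hinv x]
  have hy : y + χ y + δ * p (y + χ y) = y := by linarith [hinv y]
  exact ⟨x + χ x, y + χ y, by rw [hx, hy, hfst], by rw [hx]; linarith⟩

theorem HasIntersectionProperty.intersectionEstimate {a b : ℝ} {f g : ℂ → ℂ → ℂ}
    (h : HasIntersectionProperty ω a b (twistMap δ f g)) (hω : ∀ i, |ω i| ≤ 1)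
    (hδ : 0 < δ) (hδ1 : δ < 1) (hα : α ∈ Set.Icc (a + η) (b - η))
    (hF : ∀ x y : ℝ, |y| ≤ η → (f (x : ℂ) ((α + y : ℝ) : ℂ)).re = δ * F x y)
    (hG : ∀ x y : ℝ, |y| ≤ η → (g (x : ℂ) ((α + y : ℝ) : ℂ)).re = G x y)
    (hρ : 0 < ρ) (hcρ : c ≤ ρ / 8) (hcη : c ≤ η) :
    IntersectionEstimate ω (δ * α) δ F G ρ c := by
  intro p v hp hv
  obtain ⟨ξ, ζ, hfst, hsnd⟩ :=
    h.exists_parameters hω hδ hδ1 hα hF hG hρ hcρ hcη hp hv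
  set d := ζ - (ξ + δ * α) with hd
  have hlip {u : ℝ → ℝ} (hu : APNormLE ω ρ c u) : |u ζ - u (ξ + δ * α)| ≤ 1 / 2 * |d| :=
    (hu.abs_sub_le hω hρ ζ _).trans
      (mul_le_mul_of_nonneg_right (by rw [div_le_iff₀ hρ]; linarith) (abs_nonneg _))
  have hdist : |d| ≤ |errX (δ * α) δ F p v ξ| + 1 / 2 * |d| := by
    have hd_eq : d = δ * -(errX (δ * α) δ F p v ξ + (p ζ - p (ξ + δ * α))) := by
      rw [hd, errX]; linarith
    calc |d| ≤ 1 * |errX (δ * α) δ F p v ξ + (p ζ - p (ξ + δ * α))| := by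
          rw [hd_eq, abs_mul, abs_neg, abs_of_pos hδ]
          exact mul_le_mul_of_nonneg_right hδ1.le (abs_nonneg _)
      _ ≤ _ := by linarith [abs_add_le (errX (δ * α) δ F p v ξ) (p ζ - p (ξ + δ * α)), hlip hp]
  refine ⟨ξ, ?_⟩
  have herr : errY (δ * α) δ G p v ξ = -(v ζ - v (ξ + δ * α)) := by rw [errY]; linarith
  rw [herr, abs_neg]
  linarith [hlip hv]

end Intersection

namespace APNormLE

variable {ω : ℕ+ → ℝ} {ρ K δ : ℝ} {u : ℝ → ℝ}

theorem const_mul_of_abs_le_one (hu : APNormLE ω ρ K u) (hδ : |δ| ≤ 1) :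
    APNormLE ω ρ K fun x => δ * u x :=
  (hu.const_mul δ).mono (mul_le_of_le_one_left hu.nonneg hδ)

theorem one_add (hu : APNormLE ω ρ K u) : APNormLE ω ρ (1 + K) fun x => 1 + u x :=
  ((const hu.width_nonneg 1).mono (by simp)).add hu

theorem of_sub_one (hu : APNormLE ω ρ K fun x => u x - 1) : APNormLE ω ρ (1 + K) u :=
  hu.one_add.congr fun x => by ring

theorem one_half_le (hu : APNormLE ω ρ K fun x => u x - 1) (hK : K ≤ 1 / 2) (x : ℝ) :
    1 / 2 ≤ u x := by
  linarith [(_root_.abs_le.1 ((hu.abs_le x).trans hK)).1]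

theorem inv_sub_one (hu : APNormLE ω ρ K fun x => u x - 1) (hK : K ≤ 1 / 2) :
    APNormLE ω ρ (2 * K) fun x => (u x)⁻¹ - 1 := by
  refine ((hu.inv_one_add_sub_one (by linarith)).mono ?_).congr fun x => by ring_nf
  refine mul_le_mul_of_nonneg_right ?_ hu.nonneg
  rw [inv_le_comm₀ (by linarith) (by norm_num)]
  linarith

theorem inv (hu : APNormLE ω ρ K fun x => u x - 1) (hK : K ≤ 1 / 2) :
    APNormLE ω ρ 2 fun x => (u x)⁻¹ :=
  (hu.inv_sub_one hK).of_sub_one.mono (by linarith)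

end APNormLE

section LinearizedEquation

variable {ω : ℕ+ → ℝ} {ρ σ Γ β e κ : ℝ} {m : ℝ → ℝ}

theorem exists_linear_solution_normal (hΓ : 0 ≤ Γ) (hdiv : DivisorEstimate ω β σ Γ)
    {d E₁ E₂ : ℝ → ℝ} (hE₁ : APNormLE ω (ρ + σ) e E₁) (hE₂ : APNormLE ω (ρ + σ) e E₂)
    (hd : APNormLE ω (ρ + σ) (1 / 8) d) (hm : APNormLE ω (ρ + σ) (1 / 16) fun x => m x - 1)
    (hκ : 0 ≤ κ) (hρ : 0 ≤ ρ) :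
    ∃ (U : ℝ → ℝ) (C : ℝ), APNormLE ω ρ (4 * (Γ * e)) U ∧
      ∀ x, m (x + β) * (U (x + β) - κ * U x) = -E₂ x + d x * E₁ x + m (x + β) * C := by
  have hm_shift : APNormLE ω (ρ + σ) (1 / 16) fun x => m (x + β) - 1 := hm.shift β
  have hrhs : APNormLE ω (ρ + σ) (4 * e) fun x => (-E₂ x + d x * E₁ x) * (m (x + β))⁻¹ :=
    ((hE₂.neg.add (hd.mul hE₁)).mul (hm_shift.inv (by norm_num))).mono
      (by linarith [hE₁.nonneg])
  obtain ⟨U, C, -, hU, hsol⟩ := hrhs.exists_cohomological_solution hρ hdiv hκ hΓ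
  refine ⟨U, -C, hU.mono (by linarith), fun x => ?_⟩
  have hm_ne : m (x + β) ≠ 0 := by linarith [hm_shift.one_half_le (by norm_num) x]
  rw [hsol x]
  field_simp
  ring

theorem exists_linear_solution_tangent (hΓ : 0 ≤ Γ) (hdiv : DivisorEstimate ω β σ Γ) (hρ : 0 ≤ ρ)
    {L : ℝ} {Y Z : ℝ → ℝ} (hY : APNormLE ω (ρ + σ) L Y)
    (hZ : APNormLE ω (ρ + σ) (1 / 2) fun x => Z x - 1) :
    ∃ (V : ℝ) (ζ : ℝ → ℝ), |V| ≤ 2 * L ∧ APNormLE ω ρ (2 * (Γ * L)) ζ ∧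
      ∀ x, ζ (x + β) - ζ x = Y x + V * Z x := by
  obtain ⟨ζY, y, hy, hζY, hsolY⟩ :=
    hY.exists_cohomological_solution hρ hdiv zero_le_one hΓ
  obtain ⟨ζZ, z, hz, hζZ, hsolZ⟩ :=
    hZ.exists_cohomological_solution hρ hdiv zero_le_one hΓ
  have hz_pos : 0 < 1 + z := by linarith [(abs_le.1 hz).1]
  -- With this choice of `V` the right-hand side has mean value zero.
  have hVz : -y / (1 + z) * (1 + z) = -y := div_mul_cancel₀ _ hz_pos.ne'
  set V := -y / (1 + z) with hV
  have hV_le : |V| ≤ 2 * L := by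
    rw [hV, abs_div, abs_neg, abs_of_pos hz_pos, div_le_iff₀ hz_pos]
    nlinarith [hY.nonneg, (abs_le.1 hz).1]
  refine ⟨V, fun x => ζY x + V * ζZ x, hV_le, (hζY.add (hζZ.const_mul V)).mono ?_, fun x => ?_⟩
  · nlinarith [mul_le_mul_of_nonneg_right hV_le hΓ]
  · linear_combination hsolY x + V * hsolZ x - hVz

theorem exists_linear_solution (hρ : 0 ≤ ρ) (hσ : 0 < σ) (hΓ : 1 ≤ Γ)
    (hdiv : DivisorEstimate ω β σ Γ) {E₁ E₂ d n f : ℝ → ℝ}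
    (hE₁ : APNormLE ω (ρ + 2 * σ) e E₁) (hE₂ : APNormLE ω (ρ + 2 * σ) e E₂)
    (hd : APNormLE ω (ρ + 2 * σ) (1 / 8) d) (hn : APNormLE ω (ρ + 2 * σ) (1 / 8) fun x => n x - 1)
    (hf : APNormLE ω (ρ + 2 * σ) (1 / 16) f)
    (hm : APNormLE ω (ρ + 2 * σ) (1 / 16) fun x => m x - 1) (hκ : |κ - 1| ≤ 1 / 16) :
    ∃ (U ζ : ℝ → ℝ) (C : ℝ), APNormLE ω (ρ + σ) (24 * (Γ * e)) U ∧
      APNormLE ω ρ (20 * (Γ ^ 2 * e)) ζ ∧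
      (∀ x, ζ (x + β) - ζ x = ((1 + f x) * (m x * U x) - E₁ x) * n x) ∧
      ∀ x, m (x + β) * (U (x + β) - κ * U x) = -E₂ x + d x * E₁ x + m (x + β) * C := by
  have hwidth : ρ + 2 * σ = ρ + σ + σ := by ring
  have hρσ : 0 ≤ ρ + σ := by linarith
  have hΓ0 : 0 ≤ Γ := by linarith
  rw [hwidth] at hE₁ hE₂ hd hn hf hm
  have he := hE₁.nonneg
  have hΓe : e ≤ Γ * e := le_mul_of_one_le_left he hΓ
  obtain ⟨U₀, C, hU₀, hnormal⟩ := exists_linear_solution_normal (κ := κ) hΓ0 hdiv hE₁ hE₂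
    hd hm (by linarith [(abs_le.1 hκ).1]) hρσ
  have hn_le : APNormLE ω (ρ + σ + σ) (9 / 8) n := hn.of_sub_one.mono (by norm_num)
  have hm_le : APNormLE ω (ρ + σ + σ) (17 / 16) m := hm.of_sub_one.mono (by norm_num)
  have hZ : APNormLE ω (ρ + σ) (1 / 2) fun x => (1 + f x) * m x * n x - 1 :=
    (((((hf.mul hm_le).mul hn_le).add ((hm.mul hn_le).add hn)).mono (by norm_num)).congr
      fun x => by ring).mono_width hρσ (by linarith)
  have hY : APNormLE ω (ρ + σ) (10 * (Γ * e)) fun x =>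
      (1 + f x) * m x * n x * U₀ x - E₁ x * n x :=
    ((hZ.of_sub_one.mul hU₀).sub ((hE₁.mul hn_le).mono_width hρσ (by linarith))).mono
      (by linarith)
  obtain ⟨V, ζ, hV, hζ, htangent⟩ := exists_linear_solution_tangent hΓ0 hdiv hρ hY hZ
  refine ⟨fun x => U₀ x + V, ζ, C + (1 - κ) * V, ?_, hζ.mono (le_of_eq (by ring)),
    fun x => ?_, fun x => ?_⟩
  · exact (hU₀.add (APNormLE.const hρσ V)).mono (by linarith)
  · linear_combination htangent x
  · linear_combination hnormal x

theorem exists_cocycle_correction (hρ : 0 ≤ ρ) (hσ : 0 < σ) (hΓ : 1 ≤ Γ)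
    (hdiv : DivisorEstimate ω β σ Γ) {b : ℝ → ℝ}
    (hm : APNormLE ω (ρ + σ) (1 / 16) fun x => m x - 1) (hκ : |κ - 1| ≤ 1 / 16)
    (hE : APNormLE ω (ρ + σ) e fun x => κ * m (x + β) - b x * m x) :
    ∃ (m' : ℝ → ℝ) (κ' : ℝ), APNormLE ω ρ (8 * (Γ * e)) (fun x => m' x - m x) ∧
      |κ' - κ| ≤ 8 * (Γ * e) ∧
      APNormLE ω ρ (100 * (e * (Γ * e))) fun x => κ' * m' (x + β) - b x * m' x := by
  obtain ⟨hκ_low, hκ_up⟩ := abs_le.1 hκ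
  have hκ_pos : 0 < κ := by linarith
  have he := hE.nonneg
  have hΓe : e ≤ Γ * e := le_mul_of_one_le_left he hΓ
  have hm_shift : APNormLE ω (ρ + σ) (1 / 16) fun x => m (x + β) - 1 := hm.shift β
  have hκ_inv : |-κ⁻¹| ≤ 2 := by
    rw [abs_neg, abs_of_pos (inv_pos.2 hκ_pos), inv_le_comm₀ hκ_pos (by norm_num)]
    linarith
  have hrhs : APNormLE ω (ρ + σ) (4 * e) fun x =>
      -κ⁻¹ * ((κ * m (x + β) - b x * m x) * (m (x + β))⁻¹) :=
    ((hE.mul (hm_shift.inv (by norm_num))).const_mul (-κ⁻¹)).mono (by nlinarith)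
  obtain ⟨χ, τ, hτ, hχ, hsol⟩ :=
    hrhs.exists_cohomological_solution hρ hdiv zero_le_one (by linarith)
  have hm_le : APNormLE ω ρ 2 m :=
    (hm.of_sub_one.mono (by norm_num)).mono_width hρ (by linarith)
  have hκτ : |κ * τ| ≤ 8 * e := by
    rw [abs_mul, abs_of_pos hκ_pos]
    nlinarith [abs_nonneg τ]
  refine ⟨fun x => m x * (1 + χ x), κ * (1 + τ), ?_, ?_, ?_⟩
  · exact ((hm_le.mul hχ).mono (by linarith)).congr fun x => by ring
  · rw [show κ * (1 + τ) - κ = κ * τ by ring]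
    linarith
  · have hquad := (((hm_le.shift β).mul (hχ.shift β)).const_mul (κ * τ)).add
      ((hE.mono_width hρ (by linarith)).mul hχ)
    refine (hquad.mono ?_).congr fun x => ?_
    · have hnonneg : 0 ≤ Γ * e := by linarith
      nlinarith [mul_le_mul_of_nonneg_right hκτ hnonneg, mul_nonneg he hnonneg]
    · have hm_ne : m (x + β) ≠ 0 := by linarith [hm_shift.one_half_le (by norm_num) x]
      have hlin : κ * m (x + β) * (χ (x + β) - χ x + τ) = -(κ * m (x + β) - b x * m x) := by
        have hsol_x : χ (x + β) - χ x + τ =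
            -κ⁻¹ * ((κ * m (x + β) - b x * m x) * (m (x + β))⁻¹) := by linarith [hsol x]
        rw [hsol_x]
        field_simp
      linear_combination -hlin

theorem APNormLE.mul_inv_one_add_mul_sub {t τ : ℝ} {a a' b b' f f' : ℝ → ℝ}
    (ha : APNormLE ω ρ (1 / 16) a) (ha' : APNormLE ω ρ (1 / 16) a')
    (hb : APNormLE ω ρ (1 / 16) b) (hf' : APNormLE ω ρ (1 / 16) f')
    (haa : APNormLE ω ρ t fun x => a' x - a x) (hbb : APNormLE ω ρ t fun x => b' x - b x)
    (hff : APNormLE ω ρ τ fun x => f' x - f x) :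
    APNormLE ω ρ (3 * t + τ) fun x =>
      b' x * (1 + a' x)⁻¹ * (1 + f' x) - b x * (1 + a x)⁻¹ * (1 + f x) := by
  have one_add_sub {u : ℝ → ℝ} (hu : APNormLE ω ρ (1 / 16) u) :
      APNormLE ω ρ (1 / 16) fun x => 1 + u x - 1 := hu.congr fun x => by ring
  have one_add_ne {u : ℝ → ℝ} (hu : APNormLE ω ρ (1 / 16) u) (x : ℝ) : 1 + u x ≠ 0 := by
    linarith [(one_add_sub hu).one_half_le (by norm_num) x]
  have hinv := (one_add_sub ha).inv (by norm_num)
  have hinv' := (one_add_sub ha').inv (by norm_num)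
  have hinv_sub : APNormLE ω ρ (4 * t) fun x => (1 + a' x)⁻¹ - (1 + a x)⁻¹ := by
    refine ((haa.mul (hinv'.mul hinv)).neg.mono (by linarith)).congr fun x => ?_
    have := one_add_ne ha x
    have := one_add_ne ha' x
    field_simp
    ring
  have hsum := (((hbb.mul hinv').add (hb.mul hinv_sub)).mul hf'.one_add).add
    ((hb.mul hinv).mul hff)
  exact (hsum.mono (by linarith [haa.nonneg, hff.nonneg])).congr fun x => by ring

end LinearizedEquation

section NewtonStep

variable {ω : ℕ+ → ℝ} {β δ ρ σ r s c k e T Γ κ C : ℝ} {F G : ℝ → ℝ → ℝ}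
  {p v m q w ζ U : ℝ → ℝ}

/-- The perturbations `F` and `G` for which the Newton iteration is run. -/
structure IsSmallPerturbation (ω : ℕ+ → ℝ) (r s : ℝ) (F : ℝ → ℝ → ℝ) : Prop where
  normLE : BandNormLE ω r s 1 F
  partialY_normLE : BandNormLE ω r s (1 / 16) (partialY F)

/-- The multiplier of the linearized mapping on the quotient by the tangent direction of the curve
`ξ ↦ (ξ + δ p(ξ), α + v(ξ))`, which is invariant up to small errors. -/
noncomputable def normalCocycle (β δ : ℝ) (F G : ℝ → ℝ → ℝ) (p v : ℝ → ℝ) (x : ℝ) : ℝ :=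
  1 + partialY G (x + δ * p x) (v x) -
    δ * deriv v (x + β) * (1 + δ * deriv p (x + β))⁻¹ * (1 + partialY F (x + δ * p x) (v x))

/-- An approximately invariant curve `ξ ↦ (ξ + δ p(ξ), α + v(ξ))` together with an approximate
reduction `m` of its normal cocycle to a constant `κ`. The curve has size `k` and the errors have
size `e`. -/
structure IsApproxCurve (ω : ℕ+ → ℝ) (β δ : ℝ) (F G : ℝ → ℝ → ℝ) (ρ k e : ℝ) (p v m : ℝ → ℝ)
    (κ : ℝ) : Prop where
  p_le : APNormLE ω ρ k p
  deriv_p_le : APNormLE ω ρ k (deriv p)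
  v_le : APNormLE ω ρ k v
  deriv_v_le : APNormLE ω ρ k (deriv v)
  m_le : APNormLE ω ρ k fun x => m x - 1
  κ_le : |κ - 1| ≤ k
  errX_le : APNormLE ω ρ e (errX β δ F p v)
  errY_le : APNormLE ω ρ e (errY β δ G p v)
  cocycle_le : APNormLE ω ρ e fun x => κ * m (x + β) - normalCocycle β δ F G p v x * m x

theorem IsApproxCurve.mono {ρ' k' e' : ℝ} (h : IsApproxCurve ω β δ F G ρ k e p v m κ)
    (hρ' : 0 ≤ ρ') (hρ : ρ' ≤ ρ) (hk : k ≤ k') (he : e ≤ e') :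
    IsApproxCurve ω β δ F G ρ' k' e' p v m κ where
  p_le := (h.p_le.mono hk).mono_width hρ' hρ
  deriv_p_le := (h.deriv_p_le.mono hk).mono_width hρ' hρ
  v_le := (h.v_le.mono hk).mono_width hρ' hρ
  deriv_v_le := (h.deriv_v_le.mono hk).mono_width hρ' hρ
  m_le := (h.m_le.mono hk).mono_width hρ' hρ
  κ_le := h.κ_le.trans hk
  errX_le := (h.errX_le.mono he).mono_width hρ' hρ
  errY_le := (h.errY_le.mono he).mono_width hρ' hρ
  cocycle_le := (h.cocycle_le.mono he).mono_width hρ' hρ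

/-- The linearized invariance equation for a correction `ζ` along the curve and `U` along its
approximately invariant normal direction. It is solved up to the constant `C`. -/
structure SolvesLinearized (β δ : ℝ) (F G : ℝ → ℝ → ℝ) (p v m : ℝ → ℝ) (κ : ℝ) (ζ U : ℝ → ℝ)
    (C : ℝ) : Prop where
  tangent (x : ℝ) : ζ (x + β) - ζ x =
    ((1 + partialY F (x + δ * p x) (v x)) * (m x * U x) - errX β δ F p v x) *
      (1 + δ * deriv p (x + β))⁻¹
  normal (x : ℝ) : m (x + β) * (U (x + β) - κ * U x) =
    -errY β δ G p v x + δ * deriv v (x + β) * (1 + δ * deriv p (x + β))⁻¹ * errX β δ F p v x +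
      m (x + β) * C

/-- The first component of the correction `ζ · (tangent) + U · m · (normal)`, divided by `δ`. -/
noncomputable def correctionX (δ : ℝ) (p ζ : ℝ → ℝ) (x : ℝ) : ℝ :=
  (1 + δ * deriv p x) * ζ x

/-- The second component of the correction `ζ · (tangent) + U · m · (normal)`. -/
noncomputable def correctionY (δ : ℝ) (v m ζ U : ℝ → ℝ) (x : ℝ) : ℝ :=
  δ * (ζ x * deriv v x) + m x * U x

/-- The second order remainder of `F` along the correction `(δ q, w)` of a curve. -/
noncomputable def taylorRemainder (δ : ℝ) (F : ℝ → ℝ → ℝ) (p v q w : ℝ → ℝ) (x : ℝ) : ℝ :=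
  F (x + δ * (p x + q x)) (v x + w x) - F (x + δ * p x) (v x) -
    (partialX F (x + δ * p x) (v x) * (δ * q x) + partialY F (x + δ * p x) (v x) * w x)

section Identities

variable {x : ℝ}

theorem hasDerivAt_comp_curve
    (hF : DifferentiableAt ℝ (Function.uncurry F) (x + δ * p x, v x))
    (hp : Differentiable ℝ p) (hv : Differentiable ℝ v) :
    HasDerivAt (fun x => F (x + δ * p x) (v x))
      (partialX F (x + δ * p x) (v x) * (1 + δ * deriv p x) +
        partialY F (x + δ * p x) (v x) * deriv v x) x :=
  hasDerivAt_comp_pair hF ((hasDerivAt_id x).add ((hp x).hasDerivAt.const_mul δ))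
    (hv x).hasDerivAt

theorem deriv_errX (hF : DifferentiableAt ℝ (Function.uncurry F) (x + δ * p x, v x))
    (hp : Differentiable ℝ p) (hv : Differentiable ℝ v) :
    deriv (errX β δ F p v) x = deriv p (x + β) - deriv p x - deriv v x -
      (partialX F (x + δ * p x) (v x) * (1 + δ * deriv p x) +
        partialY F (x + δ * p x) (v x) * deriv v x) :=
  (((((hp (x + β)).hasDerivAt.comp_add_const x β).sub (hp x).hasDerivAt).sub
    (hv x).hasDerivAt).sub (hasDerivAt_comp_curve hF hp hv)).deriv

theorem deriv_errY (hG : DifferentiableAt ℝ (Function.uncurry G) (x + δ * p x, v x))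
    (hp : Differentiable ℝ p) (hv : Differentiable ℝ v) :
    deriv (errY β δ G p v) x = deriv v (x + β) - deriv v x -
      (partialX G (x + δ * p x) (v x) * (1 + δ * deriv p x) +
        partialY G (x + δ * p x) (v x) * deriv v x) :=
  ((((hv (x + β)).hasDerivAt.comp_add_const x β).sub (hv x).hasDerivAt).sub
    (hasDerivAt_comp_curve hG hp hv)).deriv

theorem SolvesLinearized.errX_add (h : SolvesLinearized β δ F G p v m κ ζ U C)
    (hF : DifferentiableAt ℝ (Function.uncurry F) (x + δ * p x, v x))
    (hp : Differentiable ℝ p) (hv : Differentiable ℝ v) (hne : 1 + δ * deriv p (x + β) ≠ 0) :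
    errX β δ F (p + correctionX δ p ζ) (v + correctionY δ v m ζ U) x =
      δ * (ζ x * deriv (errX β δ F p v) x) -
        taylorRemainder δ F p v (correctionX δ p ζ) (correctionY δ v m ζ U) x := by
  have htangent : (1 + δ * deriv p (x + β)) * (ζ (x + β) - ζ x) =
      (1 + partialY F (x + δ * p x) (v x)) * (m x * U x) - errX β δ F p v x := by
    rw [h.tangent x]
    field_simp
  have hderiv := deriv_errX (β := β) hF hp hv
  simp only [errX] at htangent
  simp only [errX, taylorRemainder, Pi.add_apply, correctionX, correctionY] at hderiv ⊢
  linear_combination htangent - δ * ζ x * hderiv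

theorem SolvesLinearized.errY_add (h : SolvesLinearized β δ F G p v m κ ζ U C)
    (hG : DifferentiableAt ℝ (Function.uncurry G) (x + δ * p x, v x))
    (hp : Differentiable ℝ p) (hv : Differentiable ℝ v) :
    errY β δ G (p + correctionX δ p ζ) (v + correctionY δ v m ζ U) x - m (x + β) * C =
      (κ * m (x + β) - normalCocycle β δ F G p v x * m x) * U x +
        δ * (ζ x * deriv (errY β δ G p v) x) -
        taylorRemainder δ G p v (correctionX δ p ζ) (correctionY δ v m ζ U) x := by
  have htangent := h.tangent x
  have hnormal := h.normal x
  have hderiv := deriv_errY (β := β) hG hp hv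
  simp only [errY] at hnormal
  simp only [errY, normalCocycle, taylorRemainder, Pi.add_apply, correctionX, correctionY]
    at hderiv ⊢
  linear_combination δ * deriv v (x + β) * htangent + hnormal - δ * ζ x * hderiv

end Identities

theorem IsApproxCurve.inv_one_add_deriv_sub_one (h : IsApproxCurve ω β δ F G ρ k e p v m κ)
    (hδ : |δ| ≤ 1) (hk : k ≤ 1 / 16) :
    APNormLE ω ρ (1 / 8) fun x => (1 + δ * deriv p (x + β))⁻¹ - 1 := by
  have ha : APNormLE ω ρ k fun x => 1 + δ * deriv p (x + β) - 1 :=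
    ((h.deriv_p_le.shift β).const_mul_of_abs_le_one hδ).congr fun x => by ring
  exact (ha.inv_sub_one (by linarith)).mono (by linarith)

theorem IsApproxCurve.one_add_deriv_ne_zero (h : IsApproxCurve ω β δ F G ρ k e p v m κ)
    (hδ : |δ| ≤ 1) (hk : k ≤ 1 / 16) (x : ℝ) : 1 + δ * deriv p (x + β) ≠ 0 := by
  have ha := ((h.deriv_p_le.shift β).const_mul_of_abs_le_one hδ).abs_le x
  linarith [(abs_le.1 ha).1]

theorem IsApproxCurve.exists_solvesLinearized
    (h : IsApproxCurve ω β δ F G (ρ + 2 * σ) k e p v m κ) (hω : ∀ i, |ω i| ≤ 1) (hρ : 0 ≤ ρ)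
    (hσ : 0 < σ) (hΓ : 1 ≤ Γ) (hdiv : DivisorEstimate ω β σ Γ) (hδ : |δ| ≤ 1)
    (hk : k ≤ 1 / 16) (hF : BandNormLE ω r s (1 / 16) (partialY F)) (hr : ρ + 2 * σ + k ≤ r)
    (hs : k ≤ s) :
    ∃ (ζ U : ℝ → ℝ) (C : ℝ), APNormLE ω ρ (24 * (Γ ^ 2 * e)) ζ ∧
      APNormLE ω ρ (24 * (Γ ^ 2 * e)) U ∧ SolvesLinearized β δ F G p v m κ ζ U C := by
  have hn := h.inv_one_add_deriv_sub_one hδ hk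
  have hd : APNormLE ω (ρ + 2 * σ) (1 / 8) fun x =>
      δ * deriv v (x + β) * (1 + δ * deriv p (x + β))⁻¹ :=
    ((((h.deriv_v_le.shift β).const_mul_of_abs_le_one hδ).mono hk).mul hn.of_sub_one).mono
      (by norm_num)
  have hf := hF.comp_line hω (h.p_le.const_mul_of_abs_le_one hδ) h.v_le hr hs
  have he := h.errX_le.nonneg
  obtain ⟨U, ζ, C, hU, hζ, htangent, hnormal⟩ := exists_linear_solution hρ hσ hΓ hdiv h.errX_le
    h.errY_le hd hn hf (h.m_le.mono hk) (h.κ_le.trans hk)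
  have hΓe : Γ * e ≤ Γ ^ 2 * e :=
    mul_le_mul_of_nonneg_right (le_self_pow₀ hΓ two_ne_zero) he
  exact ⟨ζ, U, C, hζ.mono (by nlinarith [sq_nonneg Γ]),
    (hU.mono (by linarith)).mono_width hρ (by linarith), htangent, hnormal⟩

/-- The components `ζ`, `U` of a correction in the frame of the curve, the correction `(δ q, w)`
itself and its derivatives have size at most `T`. -/
structure IsSmallCorrection (ω : ℕ+ → ℝ) (ρ T : ℝ) (ζ U q w : ℝ → ℝ) : Prop where
  ζ_le : APNormLE ω ρ T ζ
  U_le : APNormLE ω ρ T U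
  q_le : APNormLE ω ρ T q
  w_le : APNormLE ω ρ T w
  deriv_q_le : APNormLE ω ρ T (deriv q)
  deriv_w_le : APNormLE ω ρ T (deriv w)

theorem IsApproxCurve.isSmallCorrection {K : ℝ}
    (h : IsApproxCurve ω β δ F G (ρ + σ) k e p v m κ) (hω : ∀ i, |ω i| ≤ 1) (hρ : 0 ≤ ρ)
    (hσ : 0 < σ) (hδ : |δ| ≤ 1) (hk : k ≤ 1 / 16) (hζ : APNormLE ω (ρ + σ) K ζ)
    (hU : APNormLE ω (ρ + σ) K U) (hT : 2 * K ≤ T) (hTσ : 2 * K / σ ≤ T) :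
    IsSmallCorrection ω ρ T ζ U (correctionX δ p ζ) (correctionY δ v m ζ U) := by
  have hK := hζ.nonneg
  have hq : APNormLE ω (ρ + σ) (2 * K) (correctionX δ p ζ) :=
    (((h.deriv_p_le.mono hk).const_mul_of_abs_le_one hδ).one_add.mul hζ).mono (by linarith)
  have hw : APNormLE ω (ρ + σ) (2 * K) (correctionY δ v m ζ U) :=
    (((hζ.mul (h.deriv_v_le.mono hk)).const_mul_of_abs_le_one hδ).add
      ((h.m_le.mono hk).of_sub_one.mul hU)).mono (by linarith)
  have narrow {u : ℝ → ℝ} (hu : APNormLE ω (ρ + σ) (2 * K) u) : APNormLE ω ρ T u :=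
    (hu.mono hT).mono_width hρ (by linarith)
  exact ⟨narrow (hζ.mono (by linarith)), narrow (hU.mono (by linarith)), narrow hq, narrow hw,
    (APNormLE.deriv hω hρ hσ hq).mono hTσ, (APNormLE.deriv hω hρ hσ hw).mono hTσ⟩

theorem BandNormLE.taylorRemainder {K : ℝ} (hF : BandNormLE ω r s K F) (hω : ∀ i, |ω i| ≤ 1)
    (hρ : 0 < ρ) (hδ : |δ| ≤ 1) (hr : ρ + 2 * c ≤ r) (hs : 2 * c ≤ s) (hp : APNormLE ω ρ c p)
    (hv : APNormLE ω ρ c v) (hq : APNormLE ω ρ T q) (hw : APNormLE ω ρ T w) (hT : 0 < T)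
    (hTc : T ≤ c) : APNormLE ω ρ (K * (T / c) ^ 2) (taylorRemainder δ F p v q w) :=
  (hF.remainder hω hρ (hp.const_mul_of_abs_le_one hδ) hv (hq.const_mul_of_abs_le_one hδ) hw hT
    hTc (by linarith) (by linarith)).congr fun x => by
      rw [SmallTwist.taylorRemainder, mul_add]

theorem SolvesLinearized.err_add_le (hsol : SolvesLinearized β δ F G p v m κ ζ U C)
    (h : IsApproxCurve ω β δ F G ρ k e p v m κ) (hω : ∀ i, |ω i| ≤ 1) (hρ : 0 < ρ)
    (hδ : |δ| ≤ 1) (hc : c ≤ 1 / 16) (hr : ρ + 2 * c ≤ r) (hs : 2 * c ≤ s)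
    (hF : BandNormLE ω r s 1 F) (hG : BandNormLE ω r s 1 G) (hkc : k ≤ c) (hT : 0 < T)
    (hTc : T ≤ c) (heT : e ≤ T)
    (hcorr : IsSmallCorrection ω ρ T ζ U (correctionX δ p ζ) (correctionY δ v m ζ U))
    (hX : APNormLE ω ρ T (deriv (errX β δ F p v)))
    (hY : APNormLE ω ρ T (deriv (errY β δ G p v))) :
    APNormLE ω ρ (2 * (T / c) ^ 2)
        (errX β δ F (p + correctionX δ p ζ) (v + correctionY δ v m ζ U)) ∧
      APNormLE ω ρ (2 * (T / c) ^ 2) fun x =>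
        errY β δ G (p + correctionX δ p ζ) (v + correctionY δ v m ζ U) x - m (x + β) * C := by
  have hc_pos : 0 < c := hT.trans_le hTc
  have hp := h.p_le.mono hkc
  have hv := h.v_le.mono hkc
  have hp_diff := hp.differentiable hω hρ
  have hv_diff := hv.differentiable hω hρ
  have hvs (x : ℝ) : |v x| < s := (hv.abs_le x).trans_lt (by linarith)
  have hT_sq : 2 * (T * T) ≤ (T / c) ^ 2 := by
    have hc_sq : 2 * c ^ 2 ≤ 1 := by nlinarith
    rw [div_pow, le_div_iff₀ (by positivity)]
    nlinarith [mul_le_mul_of_nonneg_left hc_sq (sq_nonneg T)]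
  have hremF := hF.taylorRemainder hω hρ hδ hr hs hp hv hcorr.q_le hcorr.w_le hT hTc
  have hremG := hG.taylorRemainder hω hρ hδ hr hs hp hv hcorr.q_le hcorr.w_le hT hTc
  have htransportX := (hcorr.ζ_le.mul hX).const_mul_of_abs_le_one hδ
  have htransportY := (hcorr.ζ_le.mul hY).const_mul_of_abs_le_one hδ
  have hr_pos : 0 < r := by linarith
  constructor
  · refine ((htransportX.sub hremF).mono (by linarith [mul_pos hT hT])).congr fun x => ?_
    exact (hsol.errX_add (hF.differentiableAt hω hr_pos _ (hvs x)) hp_diff hv_diff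
      (h.one_add_deriv_ne_zero hδ (hkc.trans hc) x)).symm
  · refine (((((h.cocycle_le.mono heT).mul hcorr.U_le).add htransportY).sub hremG).mono
      (by linarith)).congr fun x => ?_
    exact (hsol.errY_add (hG.differentiableAt hω hr_pos _ (hvs x)) hp_diff hv_diff).symm

theorem IntersectionEstimate.errY_le {A : ℝ} (hint : IntersectionEstimate ω β δ F G ρ c)
    (hp : APNormLE ω ρ c p) (hv : APNormLE ω ρ c v)
    (hm : APNormLE ω ρ (1 / 16) fun x => m x - 1) (hX : APNormLE ω ρ A (errX β δ F p v))
    (hY : APNormLE ω ρ A fun x => errY β δ G p v x - m (x + β) * C) :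
    APNormLE ω ρ (9 * A) (errY β δ G p v) := by
  obtain ⟨x, hx⟩ := hint p v hp hv
  have hmC : |m (x + β) * C| ≤ 2 * A := by
    have hdiff := abs_le.1 (hY.abs_le x)
    have herrY := abs_le.1 (hx.trans (hX.abs_le x))
    exact abs_le.2 ⟨by linarith, by linarith⟩
  have hm_low := hm.one_half_le (by norm_num) (x + β)
  have hC : |C| ≤ 4 * A := by
    rw [abs_mul, abs_of_pos (by linarith)] at hmC
    nlinarith [mul_le_mul_of_nonneg_right hm_low (abs_nonneg C)]
  have hm_le : APNormLE ω ρ 2 fun x => m (x + β) :=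
    (hm.of_sub_one.mono (by norm_num)).shift β
  exact ((hY.add (hm_le.mul (APNormLE.const hX.width_nonneg C))).mono (by linarith)).congr
    fun x => by ring

theorem IsApproxCurve.normalCocycle_add_sub (h : IsApproxCurve ω β δ F G ρ k e p v m κ)
    (hω : ∀ i, |ω i| ≤ 1) (hρ : 0 < ρ) (hδ : |δ| ≤ 1) (hc : c ≤ 1 / 16)
    (hr : ρ + 2 * c ≤ r) (hs : 2 * c ≤ s) (hF : BandNormLE ω r s (1 / 16) (partialY F))
    (hG : BandNormLE ω r s (1 / 16) (partialY G)) (hT : 0 < T) (hkT : k + T ≤ c)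
    (hcorr : IsSmallCorrection ω ρ T ζ U q w) :
    APNormLE ω ρ (T / c) fun x =>
      normalCocycle β δ F G (p + q) (v + w) x - normalCocycle β δ F G p v x := by
  have hk := h.p_le.nonneg
  have hkc : k ≤ c := by linarith
  have hTc : T ≤ c := by linarith
  have hp := h.p_le.mono hkc
  have hv := h.v_le.mono hkc
  have hδp := hp.const_mul_of_abs_le_one hδ
  have hδq := hcorr.q_le.const_mul_of_abs_le_one hδ
  have deriv_add_shift {u z : ℝ → ℝ} {K L : ℝ} (hu : APNormLE ω ρ K u) (hz : APNormLE ω ρ L z)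
      (x : ℝ) : deriv (u + z) (x + β) = deriv u (x + β) + deriv z (x + β) :=
    deriv_add (hu.differentiable hω hρ _) (hz.differentiable hω hρ _)
  have shift_mul {u : ℝ → ℝ} {K : ℝ} (hu : APNormLE ω ρ K u) :
      APNormLE ω ρ K fun x => δ * u (x + β) := (hu.shift β).const_mul_of_abs_le_one hδ
  have hF_diff := hF.increment hω hδp hv hδq hcorr.w_le hT hTc (by linarith) (by linarith)
  have hG_diff := hG.increment hω hδp hv hδq hcorr.w_le hT hTc (by linarith) (by linarith)
  have hproduct := ((shift_mul h.deriv_p_le).mono (hkc.trans hc)).mul_inv_one_add_mul_sub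
    ((shift_mul (h.deriv_p_le.add hcorr.deriv_q_le)).mono (hkT.trans hc))
    ((shift_mul h.deriv_v_le).mono (hkc.trans hc))
    (hF.comp_line hω (hδp.add hδq) (hv.add hcorr.w_le) (by linarith) (by linarith))
    ((shift_mul hcorr.deriv_q_le).congr fun x => by ring)
    (b' := fun x => δ * (deriv v (x + β) + deriv w (x + β)))
    ((shift_mul hcorr.deriv_w_le).congr fun x => by ring) hF_diff
  have hTD : T ≤ 1 / 16 * (T / c) := by
    rw [mul_div_assoc', le_div_iff₀ (by linarith)]
    nlinarith
  refine ((hG_diff.sub hproduct).mono (by linarith)).congr fun x => ?_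
  simp only [normalCocycle, deriv_add_shift h.p_le hcorr.q_le, deriv_add_shift h.v_le hcorr.w_le,
    Pi.add_apply, mul_add]
  ring

theorem IsApproxCurve.exists_small_correction
    (h : IsApproxCurve ω β δ F G (ρ + 4 * σ) k e p v m κ) (hω : ∀ i, |ω i| ≤ 1) (hρ : 0 ≤ ρ)
    (hσ : 0 < σ) (hΓ : 1 ≤ Γ) (hσΓ : 1 / σ ≤ Γ) (hdiv : DivisorEstimate ω β σ Γ) (hδ : |δ| ≤ 1)
    (hk : k ≤ 1 / 16) (hF : BandNormLE ω r s (1 / 16) (partialY F)) (hr : ρ + 4 * σ + k ≤ r)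
    (hs : k ≤ s) :
    ∃ (ζ U : ℝ → ℝ) (C : ℝ), SolvesLinearized β δ F G p v m κ ζ U C ∧
      IsSmallCorrection ω (ρ + σ) (50 * (Γ ^ 3 * e)) ζ U (correctionX δ p ζ)
        (correctionY δ v m ζ U) := by
  have he := h.errX_le.nonneg
  have hΓe : Γ ^ 2 * e ≤ Γ ^ 3 * e :=
    mul_le_mul_of_nonneg_right (pow_le_pow_right₀ hΓ (by norm_num)) he
  have hΓe_nonneg : 0 ≤ Γ ^ 2 * e := by positivity
  have h₂ : IsApproxCurve ω β δ F G (ρ + 2 * σ + 2 * σ) k e p v m κ :=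
    h.mono (by linarith) (by linarith) le_rfl le_rfl
  have h₁ : IsApproxCurve ω β δ F G (ρ + σ + σ) k e p v m κ :=
    h.mono (by linarith) (by linarith) le_rfl le_rfl
  obtain ⟨ζ, U, C, hζ, hU, hsol⟩ := h₂.exists_solvesLinearized hω (by linarith) hσ hΓ hdiv hδ hk
    hF (by linarith) hs
  have hwidth : ρ + 2 * σ = ρ + σ + σ := by ring
  rw [hwidth] at hζ hU
  refine ⟨ζ, U, C, hsol, h₁.isSmallCorrection hω (by linarith) hσ hδ hk hζ hU (by linarith) ?_⟩
  calc 2 * (24 * (Γ ^ 2 * e)) / σ = 48 * (Γ ^ 2 * e) * (1 / σ) := by ring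
    _ ≤ 48 * (Γ ^ 2 * e) * Γ := mul_le_mul_of_nonneg_left hσΓ (by positivity)
    _ ≤ 50 * (Γ ^ 3 * e) := by nlinarith [pow_succ Γ 2]

/-- Size of the correction in a Newton step with errors of size `e` and small divisors bounded by
`Γ`. -/
noncomputable def newtonSize (c Γ e : ℝ) : ℝ :=
  1000 / c * (Γ ^ 4 * e)

theorem IsApproxCurve.deriv_err_le (h : IsApproxCurve ω β δ F G (ρ + σ) k e p v m κ)
    (hω : ∀ i, |ω i| ≤ 1) (hρ : 0 ≤ ρ) (hσ : 0 < σ) (he : e / σ ≤ T) :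
    APNormLE ω ρ T (deriv (errX β δ F p v)) ∧ APNormLE ω ρ T (deriv (errY β δ G p v)) :=
  ⟨(APNormLE.deriv hω hρ hσ h.errX_le).mono he, (APNormLE.deriv hω hρ hσ h.errY_le).mono he⟩

theorem IsApproxCurve.exists_updated_cocycle {D : ℝ}
    (h : IsApproxCurve ω β δ F G (ρ + σ) k e p v m κ) (hρ : 0 ≤ ρ) (hσ : 0 < σ) (hΓ : 1 ≤ Γ)
    (hdiv : DivisorEstimate ω β σ Γ) (hk : k ≤ 1 / 16) (heD : e ≤ D / 2) {b : ℝ → ℝ}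
    (hb : APNormLE ω (ρ + σ) D fun x => b x - normalCocycle β δ F G p v x) :
    ∃ (m' : ℝ → ℝ) (κ' : ℝ), APNormLE ω ρ (16 * (Γ * D)) (fun x => m' x - m x) ∧
      |κ' - κ| ≤ 16 * (Γ * D) ∧
      APNormLE ω ρ (400 * (D * (Γ * D))) fun x => κ' * m' (x + β) - b x * m' x := by
  have hm := h.m_le.mono hk
  have hD := hb.nonneg
  have herr : APNormLE ω (ρ + σ) (2 * D) fun x => κ * m (x + β) - b x * m x :=
    ((h.cocycle_le.sub (hb.mul hm.of_sub_one)).mono (by linarith)).congr fun x => by ring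
  obtain ⟨m', κ', hm', hκ', herr'⟩ :=
    exists_cocycle_correction hρ hσ hΓ hdiv hm (h.κ_le.trans hk) herr
  exact ⟨m', κ', hm'.mono (by linarith), by linarith, herr'.mono (by linarith)⟩

theorem IsApproxCurve.add_correction {D : ℝ}
    (h : IsApproxCurve ω β δ F G (ρ + σ) k e p v m κ) (hω : ∀ i, |ω i| ≤ 1) (hρ : 0 ≤ ρ)
    (hσ : 0 < σ) (hΓ : 1 ≤ Γ) (hdiv : DivisorEstimate ω β σ Γ) (hδ : |δ| ≤ 1) (hc_pos : 0 < c)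
    (hc : c ≤ 1 / 16) (hr : ρ + σ + 2 * c ≤ r) (hs : 2 * c ≤ s) (hF : IsSmallPerturbation ω r s F)
    (hG : IsSmallPerturbation ω r s G) (hT : 0 < T) (hTD : T / c = D)
    (hkc : k + 20 * (Γ * D) ≤ c) (heT : e ≤ T)
    (hcorr : IsSmallCorrection ω (ρ + σ) T ζ U q w)
    (hX : APNormLE ω (ρ + σ) (18 * D ^ 2) (errX β δ F (p + q) (v + w)))
    (hY : APNormLE ω (ρ + σ) (18 * D ^ 2) (errY β δ G (p + q) (v + w))) :
    ∃ (m' : ℝ → ℝ) (κ' : ℝ), IsApproxCurve ω β δ F G ρ (k + 20 * (Γ * D)) ((20 * (Γ * D)) ^ 2)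
      (p + q) (v + w) m' κ' := by
  have hD : 0 < D := hTD ▸ div_pos hT hc_pos
  have hTD' : T = c * D := by rw [← hTD, mul_div_cancel₀ _ hc_pos.ne']
  have hΓD : D ≤ Γ * D := le_mul_of_one_le_left hD.le hΓ
  have hT16 : T ≤ D / 16 := by
    rw [hTD']
    nlinarith
  have hk : k ≤ 1 / 16 := by linarith
  have hb := h.normalCocycle_add_sub hω (by linarith) hδ hc hr hs hF.partialY_normLE
    hG.partialY_normLE hT (by linarith) hcorr
  rw [hTD] at hb
  obtain ⟨m', κ', hm', hκ', herr⟩ :=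
    h.exists_updated_cocycle hρ hσ hΓ hdiv hk (by linarith) hb
  have grow {u z : ℝ → ℝ} (hu : APNormLE ω (ρ + σ) k u) (hz : APNormLE ω (ρ + σ) T z) :
      APNormLE ω ρ (k + 20 * (Γ * D)) (u + z) :=
    ((hu.add hz).mono (by linarith)).mono_width hρ (by linarith)
  have deriv_add_eq {u z : ℝ → ℝ} (hu : APNormLE ω (ρ + σ) k u)
      (hz : APNormLE ω (ρ + σ) T z) : deriv (u + z) = deriv u + deriv z :=
    funext fun x =>
      deriv_add (hu.differentiable hω (by linarith) x) (hz.differentiable hω (by linarith) x)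
  have hsq : D ^ 2 ≤ (Γ * D) ^ 2 := pow_le_pow_left₀ hD.le hΓD 2
  have narrow {u : ℝ → ℝ} (hu : APNormLE ω (ρ + σ) (18 * D ^ 2) u) :
      APNormLE ω ρ ((20 * (Γ * D)) ^ 2) u :=
    (hu.mono (by nlinarith)).mono_width hρ (by linarith)
  refine ⟨m', κ', grow h.p_le hcorr.q_le, ?_, grow h.v_le hcorr.w_le, ?_, ?_, ?_, narrow hX,
    narrow hY, herr.mono (by nlinarith)⟩
  · rw [deriv_add_eq h.p_le hcorr.q_le]
    exact grow h.deriv_p_le hcorr.deriv_q_le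
  · rw [deriv_add_eq h.v_le hcorr.w_le]
    exact grow h.deriv_v_le hcorr.deriv_w_le
  · exact (((h.m_le.mono_width hρ (by linarith)).add hm').mono (by linarith)).congr
      fun x => by ring
  · linarith [abs_sub_le κ' κ 1, h.κ_le]

theorem IsApproxCurve.newton_step (h : IsApproxCurve ω β δ F G (ρ + 4 * σ) k e p v m κ)
    (hω : ∀ i, |ω i| ≤ 1) (hρ : 0 ≤ ρ) (hσ : 0 < σ) (hΓ : 1 ≤ Γ) (hσΓ : 1 / σ ≤ Γ)
    (hdiv : DivisorEstimate ω β σ Γ) (hδ : |δ| ≤ 1) (hc_pos : 0 < c) (hc : c ≤ 1 / 16)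
    (hr : ρ + 4 * σ + 2 * c ≤ r) (hs : 2 * c ≤ s) (hF : IsSmallPerturbation ω r s F)
    (hG : IsSmallPerturbation ω r s G) (hint : IntersectionEstimate ω β δ F G (ρ + σ) c)
    (he : 0 < e) (hkc : k + newtonSize c Γ e ≤ c) :
    ∃ (p' v' m' : ℝ → ℝ) (κ' : ℝ),
      IsApproxCurve ω β δ F G ρ (k + newtonSize c Γ e) (newtonSize c Γ e ^ 2) p' v' m' κ' ∧
        APNormLE ω ρ (newtonSize c Γ e) (fun x => p' x - p x) ∧
        APNormLE ω ρ (newtonSize c Γ e) fun x => v' x - v x := by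
  set T := 50 * (Γ ^ 3 * e) with hT_def
  set D := T / c with hD_def
  have hΓ_pos : 0 < Γ := one_pos.trans_le hΓ
  have hT : 0 < T := by positivity
  have hD : 0 < D := div_pos hT hc_pos
  have hsize : newtonSize c Γ e = 20 * (Γ * D) := by
    rw [newtonSize, hD_def, hT_def]
    ring
  have hΓD : D ≤ Γ * D := le_mul_of_one_le_left hD.le hΓ
  have hTD : T ≤ D := (le_div_iff₀ hc_pos).2 (by nlinarith)
  have heΓ : e * Γ ≤ T := by
    nlinarith [mul_le_mul_of_nonneg_right (le_self_pow₀ hΓ three_ne_zero) he.le]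
  have heT : e ≤ T := (le_mul_of_one_le_right he.le hΓ).trans heΓ
  rw [hsize] at hkc ⊢
  have hk : k ≤ c := by linarith
  obtain ⟨ζ, U, C, hsol, hcorr⟩ := h.exists_small_correction hω hρ hσ hΓ hσΓ hdiv hδ
    (by linarith) hF.partialY_normLE (by linarith) (by linarith)
  have h' : IsApproxCurve ω β δ F G (ρ + σ + σ) k e p v m κ :=
    h.mono (by linarith) (by linarith) le_rfl le_rfl
  obtain ⟨hX', hY'⟩ := h'.deriv_err_le (T := T) hω (by linarith) hσ
    (by rw [div_eq_mul_one_div]; nlinarith)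
  have h₁ := h'.mono (ρ' := ρ + σ) (by linarith) (by linarith) le_rfl le_rfl
  have hk_nonneg := h.p_le.nonneg
  obtain ⟨hX, hYC⟩ := hsol.err_add_le h₁ hω (by linarith) hδ hc (by linarith) hs hF.normLE
    hG.normLE hk hT (by linarith) heT hcorr hX' hY'
  have hY := hint.errY_le ((h₁.p_le.add hcorr.q_le).mono (by linarith))
    ((h₁.v_le.add hcorr.w_le).mono (by linarith)) (h₁.m_le.mono (by linarith)) hX hYC
  obtain ⟨m', κ', hnew⟩ := h₁.add_correction hω hρ hσ hΓ hdiv hδ hc_pos hc (by linarith) hs hF hG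
    hT rfl hkc heT hcorr (hX.mono (by nlinarith)) (hY.mono (by linarith))
  exact ⟨_, _, m', κ', hnew,
    ((hcorr.q_le.mono (by linarith)).mono_width hρ (by linarith)).congr fun x => by simp,
    ((hcorr.w_le.mono (by linarith)).mono_width hρ (by linarith)).congr fun x => by simp⟩

end NewtonStep

section Iteration

variable {ω : ℕ+ → ℝ} {γ μ r s c e₀ β δ ρ κ : ℝ} {e : ℕ → ℝ} {F G : ℝ → ℝ → ℝ}
  {p v m : ℝ → ℝ}

/-- The loss of width at the `n`-th step. -/
noncomputable def stepLoss (r : ℝ) (n : ℕ) : ℝ :=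
  r / 160 * (9 / 10) ^ n

/-- The width of the strip at the `n`-th step. -/
noncomputable def stepWidth (r : ℝ) (n : ℕ) : ℝ :=
  r / 4 + r / 4 * (9 / 10) ^ n

/-- The bound for the size of the approximate curve at the `n`-th step. -/
noncomputable def stepSize (c : ℝ) (n : ℕ) : ℝ :=
  c - c / 2 ^ n

theorem stepLoss_pos (hr : 0 < r) (n : ℕ) : 0 < stepLoss r n := by
  rw [stepLoss]
  positivity

theorem stepLoss_le_one (hr : 0 < r) (hr1 : r ≤ 1) (n : ℕ) : stepLoss r n ≤ 1 := by
  have hpow : (9 / 10 : ℝ) ^ n ≤ 1 := pow_le_one₀ (by norm_num) (by norm_num)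
  rw [stepLoss]
  nlinarith

theorem stepWidth_succ_add (r : ℝ) (n : ℕ) :
    stepWidth r (n + 1) + 4 * stepLoss r n = stepWidth r n := by
  rw [stepWidth, stepWidth, stepLoss, pow_succ]
  ring

theorem le_stepWidth (hr : 0 < r) (n : ℕ) : r / 4 ≤ stepWidth r n := by
  rw [stepWidth]
  exact le_add_of_nonneg_right (by positivity)

theorem stepWidth_le (hr : 0 < r) (n : ℕ) : stepWidth r n ≤ r / 2 := by
  have hpow : (9 / 10 : ℝ) ^ n ≤ 1 := pow_le_one₀ (by norm_num) (by norm_num)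
  rw [stepWidth]
  nlinarith

theorem stepSize_succ (c : ℝ) (n : ℕ) : stepSize c (n + 1) = stepSize c n + c / 2 / 2 ^ n := by
  rw [stepSize, stepSize, pow_succ]
  field_simp
  ring

theorem stepSize_le (hc : 0 < c) (n : ℕ) : stepSize c n ≤ c :=
  sub_le_self c (by positivity)

/-- A sequence of error bounds along which the Newton iteration closes up. -/
structure IsErrorSequence (γ μ r c : ℝ) (e : ℕ → ℝ) : Prop where
  pos (n : ℕ) : 0 < e n
  le (n : ℕ) : e n ≤ c / 2 / 2 ^ n
  newtonSize_le (n : ℕ) : newtonSize c (divisorBound γ μ (stepLoss r n)) (e n) ≤ c / 2 / 2 ^ n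
  sq_newtonSize_le (n : ℕ) :
    newtonSize c (divisorBound γ μ (stepLoss r n)) (e n) ^ 2 ≤ e (n + 1)

theorem one_div_stepLoss_pow_le (hr : 0 < r) (n : ℕ) :
    1 / stepLoss r n ^ 3 ≤ (160 / r) ^ 3 * (3 / 2) ^ n :=
  calc 1 / stepLoss r n ^ 3 = (160 / r) ^ 3 * (((9 / 10) ^ n) ^ 3)⁻¹ := by
        rw [stepLoss]
        field_simp
    _ = (160 / r) ^ 3 * (1000 / 729) ^ n := by
        rw [← pow_mul, mul_comm n, pow_mul, ← inv_pow]
        norm_num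
    _ ≤ (160 / r) ^ 3 * (3 / 2) ^ n :=
        mul_le_mul_of_nonneg_left (pow_le_pow_left₀ (by norm_num) (by norm_num) n) (by positivity)

/-- The small divisor losses grow at most like `exp (A (3/2)ⁿ)`, hence slower than the errors of a
quadratically convergent iteration decay. -/
theorem exists_stepFactor_le_exp (hγ : 0 < γ) (hr : 0 < r) (hc : 0 < c) (hc1 : c ≤ 1) :
    ∃ A : ℝ, 0 ≤ A ∧ ∀ n : ℕ,
      1000 / c * divisorBound γ μ (stepLoss r n) ^ 4 ≤ Real.exp (A * (3 / 2) ^ n) := by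
  obtain ⟨H, hH⟩ : ∃ H, H = 1000 / c * (1 + 1 / (2 * γ)) ^ 4 := ⟨_, rfl⟩
  obtain ⟨B, hB⟩ : ∃ B, B = (5 + 4 * μ) ^ 4 + 1 := ⟨_, rfl⟩
  have hB_nonneg : 0 ≤ B := by rw [hB]; positivity
  have hH_one : 1 ≤ H := hH ▸ one_le_mul_of_one_le_of_one_le
    ((one_le_div hc).2 (by linarith)) (one_le_pow₀ (le_add_of_nonneg_right (by positivity)))
  have hlog := Real.log_nonneg hH_one
  refine ⟨Real.log H + 4 * B * (160 / r) ^ 3, by positivity, fun n => ?_⟩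
  have hpow : (1 : ℝ) ≤ (3 / 2) ^ n := one_le_pow₀ (by norm_num)
  calc 1000 / c * divisorBound γ μ (stepLoss r n) ^ 4
      = Real.exp (Real.log H + 4 * (B * (1 / stepLoss r n ^ 3))) := by
        rw [divisorBound, ← hB, Real.exp_add, Real.exp_log (by linarith), mul_pow,
          ← Real.exp_nat_mul, hH, ← mul_assoc, mul_one_div]
        norm_cast
    _ ≤ Real.exp ((Real.log H + 4 * B * (160 / r) ^ 3) * (3 / 2) ^ n) := by
        rw [Real.exp_le_exp]
        nlinarith [mul_le_mul_of_nonneg_left (one_div_stepLoss_pow_le hr n) hB_nonneg]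

theorem exp_neg_mul_pow_le {M : ℝ} (hc : 0 < c) (hM : 2 + 2 / c ≤ M) (n : ℕ) :
    Real.exp (-(M * (3 / 2) ^ n)) ≤ c / 2 / 2 ^ n := by
  have hc2 : 0 < 2 / c := by positivity
  have hbernoulli : 1 + (n : ℝ) * (1 / 2) ≤ (3 / 2) ^ n := by
    have h := one_add_mul_le_pow (show (-2 : ℝ) ≤ 1 / 2 by norm_num) n
    norm_num at h ⊢
    exact h
  have hexponent : 2 / c + n ≤ M * (3 / 2) ^ n :=
    calc 2 / c + n ≤ (2 + 2 / c) * (1 + (n : ℝ) * (1 / 2)) := by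
          nlinarith [mul_nonneg hc2.le (n.cast_nonneg : (0 : ℝ) ≤ n)]
      _ ≤ M * (3 / 2) ^ n := mul_le_mul hM hbernoulli (by positivity) (by linarith)
  have htwo : (2 : ℝ) ^ n ≤ Real.exp n := by
    rw [← Real.exp_one_pow]
    exact pow_le_pow_left₀ zero_le_two (by linarith [Real.add_one_le_exp (1 : ℝ)]) n
  have hfactor : 2 / c ≤ Real.exp (2 / c) := by linarith [Real.add_one_le_exp (2 / c)]
  calc Real.exp (-(M * (3 / 2) ^ n)) ≤ Real.exp (-(2 / c + n)) :=
        Real.exp_le_exp.2 (neg_le_neg hexponent)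
    _ = (Real.exp (2 / c) * Real.exp n)⁻¹ := by rw [Real.exp_neg, Real.exp_add]
    _ ≤ (2 / c * 2 ^ n)⁻¹ := by gcongr
    _ = c / 2 / 2 ^ n := by field_simp

theorem exists_isErrorSequence (hγ : 0 < γ) (hr : 0 < r) (hc : 0 < c) (hc1 : c ≤ 1) :
    ∃ e : ℕ → ℝ, IsErrorSequence γ μ r c e := by
  obtain ⟨A, hA, hfactor⟩ := exists_stepFactor_le_exp (μ := μ) hγ hr hc hc1
  obtain ⟨L, hL⟩ : ∃ L, L = 4 * A + 2 + 2 / c := ⟨_, rfl⟩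
  have hc2 : 0 < 2 / c := by positivity
  have hsize (n : ℕ) : newtonSize c (divisorBound γ μ (stepLoss r n))
      (Real.exp (-(L * (3 / 2) ^ n))) ≤ Real.exp (-((L - A) * (3 / 2) ^ n)) := by
    rw [newtonSize, ← mul_assoc]
    calc _ ≤ Real.exp (A * (3 / 2) ^ n) * Real.exp (-(L * (3 / 2) ^ n)) :=
          mul_le_mul_of_nonneg_right (hfactor n) (Real.exp_pos _).le
      _ = Real.exp (-((L - A) * (3 / 2) ^ n)) := by
          rw [← Real.exp_add]
          ring_nf
  refine ⟨fun n => Real.exp (-(L * (3 / 2) ^ n)), fun n => Real.exp_pos _,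
    exp_neg_mul_pow_le hc (by linarith),
    fun n => (hsize n).trans (exp_neg_mul_pow_le hc (by linarith) n), fun n => ?_⟩
  calc _ ≤ Real.exp (-((L - A) * (3 / 2) ^ n)) ^ 2 :=
        pow_le_pow_left₀ (by rw [newtonSize]; positivity) (hsize n) 2
    _ = Real.exp (-(2 * (L - A) * (3 / 2) ^ n)) := by
        rw [← Real.exp_nat_mul]
        push_cast
        ring_nf
    _ ≤ Real.exp (-(L * (3 / 2) ^ (n + 1))) := by
        rw [Real.exp_le_exp, neg_le_neg_iff, pow_succ]
        have hQ : (0 : ℝ) < (3 / 2) ^ n := by positivity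
        nlinarith

theorem IntersectionEstimate.mono_width {ρ' : ℝ} (h : IntersectionEstimate ω β δ F G ρ c)
    (hρ : 0 ≤ ρ) (hρρ' : ρ ≤ ρ') : IntersectionEstimate ω β δ F G ρ' c :=
  fun p v hp hv => h p v (hp.mono_width hρ hρρ') (hv.mono_width hρ hρρ')

theorem IsApproxCurve.zero (hF : APNormLE ω ρ e₀ fun x => F x 0)
    (hG : APNormLE ω ρ e₀ fun x => G x 0) (hGy : APNormLE ω ρ e₀ fun x => partialY G x 0) :
    IsApproxCurve ω β δ F G ρ 0 e₀ 0 0 1 1 := by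
  have hzero : APNormLE ω ρ 0 0 := APNormLE.zero hF.width_nonneg
  have hderiv : deriv (0 : ℝ → ℝ) = 0 := deriv_const' 0
  have hzero_deriv : APNormLE ω ρ 0 (deriv 0) := by rwa [hderiv]
  refine ⟨hzero, hzero_deriv, hzero, hzero_deriv, hzero.congr fun x => by simp, by simp,
    hF.neg.congr fun x => by simp [errX], hG.neg.congr fun x => by simp [errY],
    hGy.neg.congr fun x => by simp [normalCocycle, hderiv]⟩

/-- The standing assumptions under which the Newton iteration converges. -/
structure NewtonSetting (ω : ℕ+ → ℝ) (γ μ β δ r s c : ℝ) (F G : ℝ → ℝ → ℝ) (e : ℕ → ℝ) :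
    Prop where
  abs_ω_le (i : ℕ+) : |ω i| ≤ 1
  γ_pos : 0 < γ
  μ_gt : -1 < μ
  nonresonant : IsNonresonant ω γ μ β
  abs_δ_le : |δ| ≤ 1
  r_pos : 0 < r
  r_le : r ≤ 1
  c_pos : 0 < c
  c_le : c ≤ 1 / 16
  c_le_width : c ≤ r / 4
  c_le_height : 2 * c ≤ s
  isSmallPerturbation_F : IsSmallPerturbation ω r s F
  isSmallPerturbation_G : IsSmallPerturbation ω r s G
  intersectionEstimate : IntersectionEstimate ω β δ F G (r / 4) c
  isErrorSequence : IsErrorSequence γ μ r c e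

theorem NewtonSetting.exists_next (hset : NewtonSetting ω γ μ β δ r s c F G e) {n : ℕ}
    (h : IsApproxCurve ω β δ F G (stepWidth r n) (stepSize c n) (e n) p v m κ) :
    ∃ (p' v' m' : ℝ → ℝ) (κ' : ℝ),
      IsApproxCurve ω β δ F G (stepWidth r (n + 1)) (stepSize c (n + 1)) (e (n + 1)) p' v' m'
        κ' ∧
      APNormLE ω (r / 4) (c / 2 / 2 ^ n) (fun x => p' x - p x) ∧
      APNormLE ω (r / 4) (c / 2 / 2 ^ n) fun x => v' x - v x := by
  have hr := hset.r_pos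
  have he := hset.isErrorSequence
  have hr4 : 0 ≤ r / 4 := by linarith
  have hσ := stepLoss_pos hr n
  have hσ1 := stepLoss_le_one hr hset.r_le n
  have hwidth := le_stepWidth hr (n + 1)
  have hwidth_succ := stepWidth_succ_add r n
  have hsize : stepSize c n + newtonSize c (divisorBound γ μ (stepLoss r n)) (e n) ≤
      stepSize c (n + 1) := by
    rw [stepSize_succ]
    linarith [he.newtonSize_le n]
  rw [← hwidth_succ] at h
  obtain ⟨p', v', m', κ', hnew, hp, hv⟩ := h.newton_step hset.abs_ω_le (hr4.trans hwidth) hσ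
    (one_le_divisorBound hset.γ_pos hσ hσ1) (one_div_le_divisorBound hset.γ_pos hσ hσ1)
    (hset.nonresonant.divisorEstimate hset.γ_pos hset.μ_gt hσ) hset.abs_δ_le hset.c_pos hset.c_le
    (by linarith [stepWidth_le hr n, hset.c_le_width]) hset.c_le_height
    hset.isSmallPerturbation_F hset.isSmallPerturbation_G
    (hset.intersectionEstimate.mono_width hr4 (by linarith)) (he.pos n)
    (hsize.trans (stepSize_le hset.c_pos _))
  exact ⟨p', v', m', κ', hnew.mono (hr4.trans hwidth) le_rfl hsize (he.sq_newtonSize_le n),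
    (hp.mono (he.newtonSize_le n)).mono_width hr4 hwidth,
    (hv.mono (he.newtonSize_le n)).mono_width hr4 hwidth⟩

theorem NewtonSetting.exists_sequence (hset : NewtonSetting ω γ μ β δ r s c F G e)
    (h : IsApproxCurve ω β δ F G (stepWidth r 0) (stepSize c 0) (e 0) p v m κ) :
    ∃ (P V M : ℕ → ℝ → ℝ) (K : ℕ → ℝ), P 0 = p ∧ V 0 = v ∧
      (∀ n, IsApproxCurve ω β δ F G (stepWidth r n) (stepSize c n) (e n) (P n) (V n) (M n)
        (K n)) ∧
      (∀ n, APNormLE ω (r / 4) (c / 2 / 2 ^ n) fun x => P (n + 1) x - P n x) ∧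
      ∀ n, APNormLE ω (r / 4) (c / 2 / 2 ^ n) fun x => V (n + 1) x - V n x := by
  let State (n : ℕ) := {t : (ℝ → ℝ) × (ℝ → ℝ) × (ℝ → ℝ) × ℝ //
    IsApproxCurve ω β δ F G (stepWidth r n) (stepSize c n) (e n) t.1 t.2.1 t.2.2.1 t.2.2.2}
  have hstep (n : ℕ) (t : State n) : ∃ t' : State (n + 1),
      (APNormLE ω (r / 4) (c / 2 / 2 ^ n) fun x => t'.1.1 x - t.1.1 x) ∧
      APNormLE ω (r / 4) (c / 2 / 2 ^ n) fun x => t'.1.2.1 x - t.1.2.1 x := by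
    obtain ⟨p', v', m', κ', hnew, hp, hv⟩ := hset.exists_next t.2
    exact ⟨⟨(p', v', m', κ'), hnew⟩, hp, hv⟩
  choose next hp hv using hstep
  let seq (n : ℕ) : State n := Nat.rec ⟨(p, v, m, κ), h⟩ next n
  exact ⟨fun n => (seq n).1.1, fun n => (seq n).1.2.1, fun n => (seq n).1.2.2.1,
    fun n => (seq n).1.2.2.2, rfl, rfl, fun n => (seq n).2, fun n => hp n (seq n),
    fun n => hv n (seq n)⟩

theorem tendsto_errX_errY {P V : ℕ → ℝ → ℝ} (hω : ∀ i, |ω i| ≤ 1) (hr : 0 < r)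
    (hF : IsSmallPerturbation ω r s F) (hG : IsSmallPerturbation ω r s G)
    (hP : ∀ x, Filter.Tendsto (fun n => P n x) Filter.atTop (nhds (p x)))
    (hV : ∀ x, Filter.Tendsto (fun n => V n x) Filter.atTop (nhds (v x)))
    (hv : ∀ x, |v x| < s) (x : ℝ) :
    Filter.Tendsto (fun n => errX β δ F (P n) (V n) x) Filter.atTop (nhds (errX β δ F p v x)) ∧
    Filter.Tendsto (fun n => errY β δ G (P n) (V n) x) Filter.atTop
      (nhds (errY β δ G p v x)) := by
  have hpoint : Filter.Tendsto (fun n => (x + δ * P n x, V n x)) Filter.atTop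
      (nhds (x + δ * p x, v x)) := (((hP x).const_mul δ).const_add x).prodMk_nhds (hV x)
  have hcomp {H : ℝ → ℝ → ℝ} (hH : IsSmallPerturbation ω r s H) :
      Filter.Tendsto (fun n => H (x + δ * P n x) (V n x)) Filter.atTop
        (nhds (H (x + δ * p x) (v x))) :=
    (hH.normLE.differentiableAt hω hr _ (hv x)).continuousAt.tendsto.comp hpoint
  exact ⟨(((hP (x + β)).sub (hP x)).sub (hV x)).sub (hcomp hF),
    ((hV (x + β)).sub (hV x)).sub (hcomp hG)⟩

theorem NewtonSetting.exists_invariant_curve (hset : NewtonSetting ω γ μ β δ r s c F G e)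
    (hF : APNormLE ω (r / 2) (e 0) fun x => F x 0) (hG : APNormLE ω (r / 2) (e 0) fun x => G x 0)
    (hGy : APNormLE ω (r / 2) (e 0) fun x => partialY G x 0) :
    ∃ p v : ℝ → ℝ, APNormLE ω (r / 4) c p ∧ APNormLE ω (r / 4) c v ∧
      (∀ x, errX β δ F p v x = 0) ∧ ∀ x, errY β δ G p v x = 0 := by
  have hr := hset.r_pos
  have he := hset.isErrorSequence
  have hstart : IsApproxCurve ω β δ F G (stepWidth r 0) (stepSize c 0) (e 0) 0 0 1 1 := by
    have hwidth : stepWidth r 0 = r / 2 := by rw [stepWidth]; ring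
    have hsize : stepSize c 0 = 0 := by rw [stepSize, pow_zero, div_one, sub_self]
    rw [hwidth, hsize]
    exact .zero hF hG hGy
  obtain ⟨P, V, M, K, hP0, hV0, hcurve, hP, hV⟩ := hset.exists_sequence hstart
  have hgeom : HasSum (fun n : ℕ => c / 2 / 2 ^ n) c := hasSum_geometric_two' c
  have hzero : APNormLE ω (r / 4) 0 0 := APNormLE.zero (by linarith)
  obtain ⟨p, hp, hp_lim⟩ := APNormLE.exists_limit (hP0 ▸ hzero) hP hgeom.summable
  obtain ⟨v, hv, hv_lim⟩ := APNormLE.exists_limit (hV0 ▸ hzero) hV hgeom.summable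
  rw [hgeom.tsum_eq, zero_add] at hp hv
  have he_lim : Filter.Tendsto e Filter.atTop (nhds 0) :=
    squeeze_zero (fun n => (he.pos n).le) he.le hgeom.summable.tendsto_atTop_zero
  have herr_lim := tendsto_errX_errY (β := β) (δ := δ) hset.abs_ω_le hr
    hset.isSmallPerturbation_F hset.isSmallPerturbation_G hp_lim hv_lim
    fun x => (hv.abs_le x).trans_lt (by linarith [hset.c_pos, hset.c_le_height])
  exact ⟨p, v, hp, hv,
    fun x => tendsto_nhds_unique (herr_lim x).1
      (squeeze_zero_norm (fun n => (hcurve n).errX_le.abs_le x) he_lim),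
    fun x => tendsto_nhds_unique (herr_lim x).2
      (squeeze_zero_norm (fun n => (hcurve n).errY_le.abs_le x) he_lim)⟩

end Iteration

section ComplexSeries

variable {ω : ℕ+ → ℝ} {r s K M N α : ℝ} {F : ℝ → ℝ → ℝ}

theorem BandNormLE.restrict {r' s' : ℝ} (hF : BandNormLE ω r s K F) (hr' : 0 ≤ r') (hr : r' ≤ r)
    (hs' : 0 < s') (hs : s' ≤ s) : BandNormLE ω r' s' K F := by
  obtain ⟨c, hc, hcK, hsum⟩ := hF.series
  refine ⟨hr', hs', SeriesNormLE.of_coeff_le (c := c)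
    (isCharSystem_band ω hr' hs').weight_nonneg (fun j => ?_) hc hcK fun x => ?_⟩
  · have := wlen_nonneg j.1
    rw [bandWeight, bandWeight, lineWeight, lineWeight]
    gcongr
  · exact hsum (x.1, ⟨x.2, (neg_le_neg hs).trans x.2.2.1, x.2.2.2.trans hs⟩)

theorem norm_taylorCoeff_le {h : ℂ → ℂ} {z : ℂ} {R : ℝ} (hR : 0 < R)
    (hh : DiffContOnCl ℂ h (Metric.ball z R)) (hM : ∀ w ∈ Metric.sphere z R, ‖h w‖ ≤ M) (k : ℕ) :
    ‖(k.factorial : ℂ)⁻¹ * iteratedDeriv k h z‖ ≤ M / R ^ k := by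
  rw [norm_mul, norm_inv, Complex.norm_natCast, inv_mul_le_iff₀ (by positivity), ← mul_div_assoc]
  exact Complex.norm_iteratedDeriv_le_of_forall_mem_sphere_norm_le k hR hh hM

theorem ofReal_add_mem_ball (hs : 0 < s) (y : Set.Icc (-(s / 4)) (s / 4)) :
    ((α + y : ℝ) : ℂ) ∈ Metric.ball (α : ℂ) s := by
  rw [Metric.mem_ball, Complex.dist_eq, ← Complex.ofReal_sub, add_sub_cancel_left,
    Complex.norm_real, Real.norm_eq_abs]
  linarith [abs_le.2 y.2]

/-- By the Cauchy estimates on the disc of radius `s / 2`, the Taylor terms of `h` on the disc of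
radius `s / 4` decay like `2 ^ (-k)`. -/
theorem seriesNormLE_mul_expMode {h : ℂ → ℂ} (hr : 0 ≤ r) (hs : 0 < s)
    (hh : DifferentiableOn ℂ h (Metric.ball (α : ℂ) s))
    (hM : ∀ y ∈ Metric.ball (α : ℂ) s, ‖h y‖ ≤ M) (l : IntVec) :
    SeriesNormLE (bandChar ω (s / 4)) (bandWeight r (s / 4)) (2 * (M * lineWeight r l))
      fun x => h ((α + x.2 : ℝ) : ℂ) * expMode ω l (x.1 : ℂ) := by
  have hball : Metric.closedBall (α : ℂ) (s / 2) ⊆ Metric.ball (α : ℂ) s :=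
    Metric.closedBall_subset_ball (by linarith)
  have hgeom := hasSum_geometric_two' (2 * (M * lineWeight r l))
  refine SeriesNormLE.hasSum (isCharSystem_band ω hr (by linarith))
    (f := fun k x => ((k.factorial : ℂ)⁻¹ * iteratedDeriv k h α) * bandChar ω (s / 4) (l, k) x)
    (fun k => (SeriesNormLE.single _ _).mono ?_) hgeom.summable hgeom.tsum_eq.le fun x => ?_
  · have hcoeff := norm_taylorCoeff_le (by linarith) ((hh.mono hball).diffContOnCl_ball subset_rfl)
      (fun w hw => hM w (hball (Metric.sphere_subset_closedBall hw))) k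
    have hW : 0 ≤ bandWeight r (s / 4) (l, k) :=
      (isCharSystem_band ω hr (by linarith)).weight_nonneg _
    calc _ ≤ M / (s / 2) ^ k * (lineWeight r l * (s / 4) ^ k) :=
          mul_le_mul_of_nonneg_right hcoeff hW
      _ = 2 * (M * lineWeight r l) / 2 / 2 ^ k := by
          have hpow : 0 < (s / 2) ^ k := by positivity
          rw [show s / 4 = s / 2 / 2 by ring, div_pow (s / 2) 2]
          generalize (s / 2) ^ k = R at hpow
          field_simp
  · refine ((Complex.hasSum_taylorSeries_on_ball hh (ofReal_add_mem_ball hs x.2)).mul_right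
      (expMode ω l (x.1 : ℂ))).congr_fun fun k => ?_
    simp only [bandChar, smul_eq_mul]
    push_cast
    ring

theorem exists_summable_sup_bound {z : ℂ} {c : IntVec → ℂ → ℂ} (hN : 0 ≤ N)
    (hc : coeffNorm r s z c ≤ ENNReal.ofReal N) :
    ∃ M : IntVec → ℝ, (∀ l, ∀ y ∈ Metric.ball z s, ‖c l y‖ ≤ M l) ∧
      Summable (fun l => M l * lineWeight r l) ∧ ∑' l, M l * lineWeight r l ≤ N := by
  rw [coeffNorm] at hc
  have htop := ne_top_of_le_ne_top ENNReal.ofReal_ne_top hc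
  have hsup (l : IntVec) : ⨆ y ∈ Metric.ball z s, ‖c l y‖ₑ ≠ ∞ := fun hl =>
    ENNReal.ne_top_of_tsum_ne_top htop l <| by
      rw [hl, ENNReal.top_mul (ENNReal.ofReal_pos.2 (Real.exp_pos _)).ne']
  have hterm (l : IntVec) : ((⨆ y ∈ Metric.ball z s, ‖c l y‖ₑ) *
      ENNReal.ofReal (Real.exp (r * wlen l))).toReal
        = (⨆ y ∈ Metric.ball z s, ‖c l y‖ₑ).toReal * lineWeight r l := by
    rw [ENNReal.toReal_mul, ENNReal.toReal_ofReal (Real.exp_pos _).le, lineWeight]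
  refine ⟨fun l => (⨆ y ∈ Metric.ball z s, ‖c l y‖ₑ).toReal, fun l y hy => ?_,
    (ENNReal.summable_toReal htop).congr hterm, ?_⟩
  · rw [← toReal_enorm]
    exact ENNReal.toReal_mono (hsup l) (le_iSup₂ (f := fun y _ => ‖c l y‖ₑ) y hy)
  · rw [← tsum_congr hterm, ← ENNReal.tsum_toReal_eq (ENNReal.ne_top_of_tsum_ne_top htop)]
    exact ENNReal.toReal_le_of_le_ofReal hN hc

theorem IsAPSeries.bandNormLE {f : ℂ → ℂ → ℂ} {c : IntVec → ℂ → ℂ}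
    (h : IsAPSeries ω r s (α : ℂ) f c) (hr : 0 < r) (hs : 0 < s) (hN : 0 ≤ N)
    (hc : coeffNorm r s (α : ℂ) c ≤ ENNReal.ofReal N) :
    BandNormLE ω r (s / 4) (2 * N) fun x y => (f (x : ℂ) ((α + y : ℝ) : ℂ)).re := by
  have hs4 : 0 < s / 4 := by linarith
  have hS := isCharSystem_band ω hr.le hs4
  obtain ⟨M, hcM, hM, hMN⟩ := exists_summable_sup_bound hN hc
  have hseries : SeriesNormLE (bandChar ω (s / 4)) (bandWeight r (s / 4)) (2 * N)
      fun x => f (x.1 : ℂ) ((α + x.2 : ℝ) : ℂ) := by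
    refine SeriesNormLE.hasSum hS
      (fun l => seriesNormLE_mul_expMode hr.le hs (h.analytic l).differentiableOn (hcM l) l)
      (hM.mul_left 2) ?_ fun x => h.hasSum _ _ (by simpa using hr) (ofReal_add_mem_ball hs x.2)
    rw [tsum_mul_left]
    linarith
  exact ⟨hr.le, hs4, hseries.re hS⟩

theorem bandNormLE_of_apNorm_lt {f : ℂ → ℂ → ℂ} (hr : 0 < r) (hs : 0 < s) (hN : 0 ≤ N)
    (h : apNorm ω r s (α : ℂ) f < ENNReal.ofReal N) :
    BandNormLE ω r (s / 4) (2 * N) fun x y => (f (x : ℂ) ((α + y : ℝ) : ℂ)).re := by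
  obtain ⟨c, hc⟩ := iInf_lt_iff.1 h
  obtain ⟨hseries, hcN⟩ := iInf_lt_iff.1 hc
  exact hseries.bandNormLE hr hs hN hcN.le

end ComplexSeries

section InvariantCurve

variable {ω : ℕ+ → ℝ} {γ μ r s ρ c K ε α β δ η : ℝ} {F G : ℝ → ℝ → ℝ} {f g : ℂ → ℂ → ℂ}
  {p v : ℝ → ℝ}

theorem BandNormLE.isSmallPerturbation (hF : BandNormLE ω r s K F) (hω : ∀ i, |ω i| ≤ 1)
    (hr : 0 < r) (hK : K ≤ 1) (hKs : K / (s / 2) ≤ 1 / 16) :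
    IsSmallPerturbation ω r (s / 2) F := by
  have hs := hF.height_pos
  have hpartial := (hF.partialY hω hr (half_pos hs) (half_lt_self hs)).mono hKs
  rw [sub_half] at hpartial
  exact ⟨(hF.restrict hr.le le_rfl (half_pos hs) (half_le_self hs.le)).mono hK, hpartial⟩

theorem BandNormLE.at_zero (hF : BandNormLE ω r s K F) (hω : ∀ i, |ω i| ≤ 1) (hρ : 0 ≤ ρ)
    (hρr : ρ ≤ r) : APNormLE ω ρ K fun x => F x 0 :=
  have hzero := APNormLE.zero (ω := ω) hρ
  (hF.comp_line hω hzero hzero (by rwa [add_zero]) hF.height_pos.le).congr fun x => by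
    rw [add_zero]

/-- The invariant curve theorem for the mapping in the rescaled form
`x₁ = x + δ (α + y) + δ F(x, y)`, `y₁ = y + G(x, y)` near the curve `y = 0`. -/
theorem exists_invariant_curve (hγ : 0 < γ) (hμ : -1 < μ) (hr : 0 < r) (hs : 0 < s) (hη : 0 < η) :
    ∃ ε ρ c : ℝ, 0 < ε ∧ 0 < ρ ∧ c ≤ ρ / 8 ∧ c ≤ η ∧
      ∀ (ω : ℕ+ → ℝ) (β δ : ℝ) (F G : ℝ → ℝ → ℝ), (∀ i, |ω i| ≤ 1) → IsNonresonant ω γ μ β →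
        |δ| ≤ 1 → BandNormLE ω r s ε F → BandNormLE ω r s ε G →
        IntersectionEstimate ω β δ F G ρ c →
        ∃ p v, APNormLE ω ρ c p ∧ APNormLE ω ρ c v ∧
          (∀ x, errX β δ F p v x = 0) ∧ ∀ x, errY β δ G p v x = 0 := by
  obtain ⟨r₁, hr₁, hr₁r, hr₁1⟩ : ∃ r₁ : ℝ, 0 < r₁ ∧ r₁ ≤ r ∧ r₁ ≤ 1 :=
    ⟨min r 1, lt_min hr one_pos, min_le_left _ _, min_le_right _ _⟩
  obtain ⟨s₁, hs₁, hs₁s, hs₁1⟩ : ∃ s₁ : ℝ, 0 < s₁ ∧ s₁ ≤ s ∧ s₁ ≤ 1 :=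
    ⟨min s 1, lt_min hs one_pos, min_le_left _ _, min_le_right _ _⟩
  obtain ⟨c, hc, hcr, hcs, hcη, hc16⟩ :
      ∃ c : ℝ, 0 < c ∧ c ≤ r₁ / 32 ∧ c ≤ s₁ / 4 ∧ c ≤ η ∧ c ≤ 1 / 16 :=
    ⟨min (min (r₁ / 32) (s₁ / 4)) (min η (1 / 16)), by positivity, by simp, by simp, by simp,
      by simp⟩
  obtain ⟨e, he⟩ := exists_isErrorSequence (μ := μ) hγ hr₁ hc (hc16.trans (by norm_num))
  obtain ⟨d, hd, hd16, hde⟩ : ∃ d : ℝ, 0 < d ∧ d ≤ 1 / 16 ∧ d ≤ e 0 :=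
    ⟨min (1 / 16) (e 0), lt_min (by norm_num) (he.pos 0), min_le_left _ _, min_le_right _ _⟩
  have hds : d * (s₁ / 2) ≤ d := mul_le_of_le_one_right hd.le (by linarith)
  have hdiv : d * (s₁ / 2) / (s₁ / 2) = d := mul_div_cancel_right₀ d (half_pos hs₁).ne'
  refine ⟨d * (s₁ / 2), r₁ / 4, c, by positivity, by positivity, by linarith, hcη,
    fun ω β δ F G hω hres hδ hF hG hint => ?_⟩
  have hF₁ := hF.restrict hr₁.le hr₁r hs₁ hs₁s
  have hG₁ := hG.restrict hr₁.le hr₁r hs₁ hs₁s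
  have hF_small := hF₁.isSmallPerturbation hω hr₁ (by linarith) (hdiv.trans_le hd16)
  have hG_small := hG₁.isSmallPerturbation hω hr₁ (by linarith) (hdiv.trans_le hd16)
  have hGy := hG₁.partialY hω hr₁ (half_pos hs₁) (half_lt_self hs₁)
  rw [hdiv] at hGy
  have hset : NewtonSetting ω γ μ β δ r₁ (s₁ / 2) c F G e :=
    ⟨hω, hγ, hμ, hres, hδ, hr₁, hr₁1, hc, hc16, by linarith, by linarith, hF_small, hG_small,
      hint, he⟩
  exact hset.exists_invariant_curve
    ((hF₁.at_zero hω (half_pos hr₁).le (half_le_self hr₁.le)).mono (hds.trans hde))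
    ((hG₁.at_zero hω (half_pos hr₁).le (half_le_self hr₁.le)).mono (hds.trans hde))
    ((hGy.at_zero hω (half_pos hr₁).le (half_le_self hr₁.le)).mono hde)

/-- The perturbation of the angle in the coordinate `y - α`, divided by `δ`. -/
noncomputable def rescaledX (δ α : ℝ) (f : ℂ → ℂ → ℂ) (x y : ℝ) : ℝ :=
  δ⁻¹ * (f (x : ℂ) ((α + y : ℝ) : ℂ)).re

/-- The perturbation of the action in the coordinate `y - α`. -/
noncomputable def rescaledY (α : ℝ) (g : ℂ → ℂ → ℂ) (x y : ℝ) : ℝ :=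
  (g (x : ℂ) ((α + y : ℝ) : ℂ)).re

theorem re_eq_mul_rescaledX (hδ : δ ≠ 0) (x y : ℝ) :
    (f (x : ℂ) ((α + y : ℝ) : ℂ)).re = δ * rescaledX δ α f x y := by
  rw [rescaledX, mul_inv_cancel_left₀ hδ]

theorem bandNormLE_rescaledX (hr : 0 < r) (hs : 0 < s) (hε : 0 < ε) (hδ : 0 < δ)
    (hf : apNorm ω r s (α : ℂ) f ≤ ENNReal.ofReal (δ * ε)) :
    BandNormLE ω r (s / 4) (4 * ε) (rescaledX δ α f) := by
  have hδε : 0 < δ * ε := mul_pos hδ hε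
  have hf := bandNormLE_of_apNorm_lt (N := 2 * (δ * ε)) hr hs (by linarith)
    (hf.trans_lt ((ENNReal.ofReal_lt_ofReal_iff (by linarith)).2 (by linarith)))
  refine ⟨hr.le, hf.height_pos, ((hf.series.const_mul ((δ⁻¹ : ℝ) : ℂ)).mono (le_of_eq ?_)).congr
    fun x => (Complex.ofReal_mul _ _).symm⟩
  rw [Complex.norm_real, Real.norm_eq_abs, abs_of_pos (inv_pos.2 hδ)]
  field_simp
  ring

theorem bandNormLE_rescaledY (hr : 0 < r) (hs : 0 < s) (hε : 0 < ε) (hδ : δ ≤ 1)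
    (hg : apNorm ω r s (α : ℂ) g ≤ ENNReal.ofReal (δ * ε)) :
    BandNormLE ω r (s / 4) (4 * ε) (rescaledY α g) := by
  have hδε : δ * ε < 2 * ε := by nlinarith
  exact (bandNormLE_of_apNorm_lt (N := 2 * ε) hr hs (by linarith)
    (hg.trans_lt ((ENNReal.ofReal_lt_ofReal_iff (by linarith)).2 hδε))).mono (by linarith)

theorem twistMap_curve (hδ : δ ≠ 0) {ξ : ℝ}
    (hX : errX (δ * α) δ (rescaledX δ α f) p v ξ = 0)
    (hY : errY (δ * α) δ (rescaledY α g) p v ξ = 0) :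
    twistMap δ f g (curve (fun x => δ * p x) (fun x => α + v x) ξ) =
      curve (fun x => δ * p x) (fun x => α + v x) (ξ + δ * α) := by
  rw [errX] at hX
  rw [errY, rescaledY] at hY
  ext
  · simp only [twistMap, curve]
    rw [re_eq_mul_rescaledX hδ]
    linear_combination -δ * hX
  · simp only [twistMap, curve]
    linear_combination -hY

theorem injective_curve (hω : ∀ i, |ω i| ≤ 1) (hρ : 0 < ρ) (hp : APNormLE ω ρ c p) (hc : c < ρ)
    (ψ : ℝ → ℝ) : Function.Injective (curve p ψ) := by
  intro x y hxy
  have hfst : x + p x = y + p y := congrArg Prod.fst hxy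
  have hlip := hp.abs_sub_le hω hρ x y
  rw [show p x - p y = -(x - y) by linarith, abs_neg] at hlip
  by_contra hne
  have hpos : 0 < |x - y| := abs_pos.2 (sub_ne_zero.2 hne)
  exact (hlip.trans_lt (mul_lt_of_lt_one_left hpos ((div_lt_one hρ).2 hc))).false

theorem image_range_eq_of_semiconj_add {A X : Type*} [AddGroup A] {M : X → X} {Γ : A → X} {a : A}
    (h : ∀ ξ, M (Γ ξ) = Γ (ξ + a)) : M '' Set.range Γ = Set.range Γ := by
  rw [← Set.range_comp, show M ∘ Γ = Γ ∘ Equiv.addRight a from funext h,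
    (Equiv.addRight a).surjective.range_comp]

end InvariantCurve

end SmallTwist

open SmallTwist in
theorem corollary2p1_general {γ μ r s : ℝ} (hγ : 0 < γ) (hμ : -1 < μ) (hr : 0 < r) (hs : 0 < s) :
    ∃ ε₀ : ℝ, 0 < ε₀ ∧ ∀ ω : ℕ+ → ℝ, (∀ i, |ω i| ≤ 1) →
      ∀ a b δ α : ℝ, 0 < δ → δ < 1 → α ∈ Set.Icc (a + γ) (b - γ) → IsNonresonant ω γ μ (δ * α) →
      ∀ f g : ℂ → ℂ → ℂ,
        apNorm ω r s (α : ℂ) f + apNorm ω r s (α : ℂ) g ≤ ENNReal.ofReal (δ * ε₀) →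
        HasIntersectionProperty ω a b (twistMap δ f g) →
        ∃ φ ψ : ℝ → ℝ, MemRealAP ω φ ∧ MemRealAP ω ψ ∧ (∀ ξ, ψ ξ ∈ Set.Icc a b) ∧
          Function.Injective (curve φ ψ) ∧
          twistMap δ f g '' Set.range (curve φ ψ) = Set.range (curve φ ψ) ∧
          ∀ ξ, twistMap δ f g (curve φ ψ ξ) = curve φ ψ (ξ + δ * α) := by
  obtain ⟨ε, ρ, c, hε, hρ, hcρ, hcγ, hcurve⟩ :=
    exists_invariant_curve (s := s / 4) hγ hμ hr (by positivity) hγ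
  refine ⟨ε / 4, by positivity, fun ω hω a b δ α hδ hδ1 hα hres f g hfg hint => ?_⟩
  have hε4 : 0 < ε / 4 := by positivity
  have hF := bandNormLE_rescaledX hr hs hε4 hδ (le_self_add.trans hfg)
  have hG := bandNormLE_rescaledY hr hs hε4 hδ1.le (le_add_self.trans hfg)
  rw [mul_div_cancel₀ ε four_ne_zero] at hF hG
  have hδ_abs : |δ| ≤ 1 := by rw [abs_of_pos hδ]; exact hδ1.le
  obtain ⟨p, v, hp, hv, hX, hY⟩ := hcurve ω (δ * α) δ _ _ hω hres hδ_abs hF hG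
    (hint.intersectionEstimate hω hδ hδ1 hα (fun x y _ => re_eq_mul_rescaledX hδ.ne' x y)
      (fun x y _ => rfl) hρ hcρ hcγ)
  have hφ := hp.const_mul_of_abs_le_one hδ_abs
  have hψ := (APNormLE.const hρ.le α).add hv
  have hinv (ξ : ℝ) := twistMap_curve hδ.ne' (hX ξ) (hY ξ)
  refine ⟨_, _, hφ.memRealAP hω hρ, hψ.memRealAP hω hρ, fun ξ => ?_,
    injective_curve hω hρ hφ (by linarith) _, image_range_eq_of_semiconj_add hinv, hinv⟩
  have hvξ := abs_le.1 ((hv.abs_le ξ).trans hcγ)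
  constructor <;> linarith [hα.1, hα.2]

theorem corollary2p1 (γ μ r s : ℝ) (hγ : 0 < γ) (hμ : 0 < μ) (hr : 0 < r) (hs : 0 < s) :
    ∃ ε₀ : ℝ, 0 < ε₀ ∧ ∀ ε : ℝ, 0 < ε → ε ≤ ε₀ →
      ∀ (ω : ℕ+ → ℝ) (γ₀ : ℝ), 0 < γ₀ → SmallTwist.IsDiophantine ω γ₀ μ →
      ∀ a b δ α : ℝ, 0 < δ → δ < 1 → α ∈ Set.Icc (a + γ) (b - γ) →
        SmallTwist.IsNonresonant ω γ μ (δ * α) →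
      ∀ f g : ℂ → ℂ → ℂ,
        SmallTwist.MemAPrs ω r s (α : ℂ) f → SmallTwist.MemAPrs ω r s (α : ℂ) g →
        SmallTwist.IsRealOn a b f → SmallTwist.IsRealOn a b g →
        SmallTwist.apNorm ω r s (α : ℂ) f + SmallTwist.apNorm ω r s (α : ℂ) g
          ≤ ENNReal.ofReal (δ * ε) →
        SmallTwist.HasIntersectionProperty ω a b (SmallTwist.twistMap δ f g) →
        ∃ φ ψ : ℝ → ℝ,
          SmallTwist.MemRealAP ω φ ∧ SmallTwist.MemRealAP ω ψ ∧
          (∀ ξ, ψ ξ ∈ Set.Icc a b) ∧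
          Function.Injective (SmallTwist.curve φ ψ) ∧
          SmallTwist.twistMap δ f g '' Set.range (SmallTwist.curve φ ψ) =
            Set.range (SmallTwist.curve φ ψ) ∧
          ∀ ξ, SmallTwist.twistMap δ f g (SmallTwist.curve φ ψ ξ) =
            SmallTwist.curve φ ψ (ξ + δ * α) := by
  obtain ⟨ε₀, hε₀, hmain⟩ := corollary2p1_general hγ (by linarith : -1 < μ) hr hs
  exact ⟨ε₀, hε₀, fun ε _ hε ω _ _ hω a b δ α hδ hδ1 hα hres f g _ _ _ _ hfg =>
    hmain ω hω.1 a b δ α hδ hδ1 hα hres f g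
      (hfg.trans (ENNReal.ofReal_le_ofReal (mul_le_mul_of_nonneg_left hε hδ.le)))⟩
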